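/- Notation. Let $\mathbb{Q}(\mathbf{x})=\mathbb{Q}(x_1,x_2,\dots)$ and let $F$ be its field endomorphism with $F(x_i)=x_{i+1}$. Put $[n]=x_1+\cdots+x_n$, $[0]!=1$ and $[n]!=[n]\cdot F([n-1]!)$. For a finite set $S=\{i_1>\cdots>i_k\}$ of positive integers put $\mathrm{wt}(S)=\prod_{j=1}^k F^{i_j-1}[j]\,/\,[k]!$. The weight of a permutation $w=(w_1,\dots,w_n)$ is defined recursively: $\mathrm{wt}(e)=1$ for $e\in\mathfrak{S}_0$, and for $n\ge 1$, with $k=w_1-1$, $$\mathrm{wt}(w)=\mathrm{wt}(S)\cdot \mathrm{wt}(a)\cdot F^{k+1}(\mathrm{wt}(\hat b)),$$ where $S$ is the set of positions of the letters $\le k$ in $w$, $a\in\mathfrak{S}_k$ is the subword of $w$ formed by these letters, and $\hat b\in\mathfrak{S}_{n-k-1}$ is the subword of the letters $>k+1$, each lowered by $k+1$. Let $\mathrm{FQSym}$ be the $\mathbb{Q}$-algebra with basis $\mathbf{F}_w$, $w\in\bigsqcup_{n\ge0}\mathfrak{S}_n$, and $\mathbf{F}_a\cdot\mathbf{F}_b=\sum_w\mathbf{F}_w$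 for $a\in\mathfrak{S}_k$, $b\in\mathfrak{S}_\ell$, the sum being over all shuffles $w$ of the words $(a_1,\dots,a_k)$ and $(b_1+k,\dots,b_\ell+k)$. For a partial order $P$ on $\{1,\dots,n\}$ let $\mathbf{F}_P=\sum_w\mathbf{F}_w$ over all linear extensions $w$ of $P$, i.e. all $w\in\mathfrak{S}_n$ such that $i$ precedes $j$ in the word $w$ whenever $i<_Pj$. Call $P$ a recursively labelled forest if every element covers at most one other element and each set $\{j: j\ge_P i\}$ is an interval of integers. Let $\mathrm{PBT}\subseteq\mathrm{FQSym}$ be the $\mathbb{Q}$-span of the $\mathbf{F}_P$ over all recursively labelled forests $P$ on $\{1,\dots,n\}$, $n\ge0$. Let $\mathbb{Q}(\mathbf{x})\#\mathbb{N}$ be the free $\mathbb{Q}(\mathbf{x})$-module on $1,u,u^2,\dots$ with the multiplication $f u^k\cdot g u^\ell=f F^k(g)\,u^{k+\ell}$, put $u^{(n)}=\frac{1}{[n]!}u^n$, and let $\phi_{\mathrm{inv}}:\mathrm{FQSym}\to\mathbb{Q}(\mathbf{x})\#\mathbb{N}$ be the $\mathbb{Q}$-linear map with $\phi_{\mathrm{inv}}(\mathbf{F}_w)=\mathrm{wt}(w)\,u^{(n)}$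 for $w\in\mathfrak{S}_n$. Proposition. $\mathrm{PBT}$ is a $\mathbb{Q}$-subalgebra of $\mathrm{FQSym}$, and the restriction of $\phi_{\mathrm{inv}}$ to it is a homomorphism of $\mathbb{Q}$-algebras $\mathrm{PBT}\to\mathbb{Q}(\mathbf{x})\#\mathbb{N}$. On all of $\mathrm{FQSym}$ the map $\phi_{\mathrm{inv}}$ is not multiplicative: $\phi_{\mathrm{inv}}(\mathbf{F}_1\cdot\mathbf{F}_{213})\ne\phi_{\mathrm{inv}}(\mathbf{F}_1)\cdot\phi_{\mathrm{inv}}(\mathbf{F}_{213})$. -/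

import Mathlib

open Finset

noncomputable section

/-! ### The field `ℚ(x₁, x₂, …)`, the Frobenius map, and the analogues of `n` and `n!` -/

/-- The field `ℚ(x₁, x₂, x₃, …)`. The polynomial variable `MvPolynomial.X i` stands for
`x_{i+1}`, so that the indices start from `0`. -/
def RatFun : Type := FractionRing (MvPolynomial ℕ ℚ)

instance : Field RatFun := inferInstanceAs (Field (FractionRing (MvPolynomial ℕ ℚ)))

instance : Algebra (MvPolynomial ℕ ℚ) RatFun :=
  inferInstanceAs (Algebra (MvPolynomial ℕ ℚ) (FractionRing (MvPolynomial ℕ ℚ)))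

instance : IsFractionRing (MvPolynomial ℕ ℚ) RatFun :=
  inferInstanceAs (IsFractionRing (MvPolynomial ℕ ℚ) (FractionRing (MvPolynomial ℕ ℚ)))

instance : CharZero RatFun :=
  charZero_of_injective_algebraMap (IsFractionRing.injective (MvPolynomial ℕ ℚ) RatFun)

/-- The indeterminate `x_{i+1}`. -/
def xvar (i : ℕ) : RatFun := algebraMap (MvPolynomial ℕ ℚ) RatFun (MvPolynomial.X i)

/-- The Frobenius map `F`, the endomorphism of `ℚ(x₁, x₂, …)` sending `x_i` to `x_{i+1}`. -/
def frob : RatFun →+* RatFun :=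
  IsFractionRing.map (A := MvPolynomial ℕ ℚ) (B := MvPolynomial ℕ ℚ)
    (j := (MvPolynomial.rename (R := ℚ) Nat.succ).toRingHom)
    (MvPolynomial.rename_injective Nat.succ Nat.succ_injective)

theorem frob_xvar (i : ℕ) : frob (xvar i) = xvar (i + 1) := by
  simp [frob, xvar, IsFractionRing.map]

/-- `[n] = x₁ + ⋯ + x_n`. -/
def bracket (n : ℕ) : RatFun := ∑ i ∈ range n, xvar i

/-- `[n]! = [n] · F([n-1]!)`, with `[0]! = 1`. -/
def bracketFactorial : ℕ → RatFun
  | 0 => 1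
  | n + 1 => bracket (n + 1) * frob (bracketFactorial n)

/-! ### The weight of a set and of a permutation -/

/-- The weight `∏_{j=1}^k F^{i_j - 1}[j] / [k]!` of a finite set `S = {i₁ > i₂ > ⋯ > i_k}` of
positive integers: the element `i = i_j` of `S` has rank `j = #{i' ∈ S | i ≤ i'}`. -/
def wtSet (S : Finset ℕ) : RatFun :=
  (∏ i ∈ S, (frob ^ (i - 1)) (bracket (S.filter (fun i' => i ≤ i')).card)) /
    bracketFactorial S.card

/-- The set of positions (counted from `1`) of the letters `< c` of a word: the position `p + 1`
carries the letter `w.getD p 0`. -/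
def positionsBelow (c : ℕ) (w : List ℕ) : Finset ℕ :=
  ((range w.length).filter (fun p => w.getD p 0 < c)).image (· + 1)

/-- The restriction of a word to its letters `< c`. -/
def lettersBelow (c : ℕ) (w : List ℕ) : List ℕ := w.filter (fun v => v < c)

/-- The restriction of a word to its letters `> c`, all lowered by `c`. -/
def lettersAbove (c : ℕ) (w : List ℕ) : List ℕ := (w.filter (fun v => c < v)).map (fun v => v - c)

theorem length_lettersBelow_le (c : ℕ) (w : List ℕ) : (lettersBelow c w).length ≤ w.length :=
  List.length_filter_le _ _

theorem length_lettersAbove_le (c : ℕ) (w : List ℕ) : (lettersAbove c w).length ≤ w.length := by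
  rw [lettersAbove, List.length_map]
  exact List.length_filter_le _ _

/-- The weight of a word `w = (w₁, …, w_n)`, meant for permutations of `{1, …, n}`.
With `c = w₁ = k + 1` and the parabolic factorization `w = u · a · b`, the set `S(u)` consists of
the positions in `w` of the letters `≤ k`, the permutation `a` is the restriction of `w` to the
letters `≤ k`, and the permutation `b̂` is its restriction to the letters `> k + 1`, lowered
by `k + 1`; then `wt(w) = wt(S(u)) · wt(a) · F^{k+1}(wt(b̂))`. -/
def wtWord : List ℕ → RatFun
  | [] => 1
  | c :: t =>
      wtSet (positionsBelow c (c :: t)) * wtWord (lettersBelow c t) *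
        (frob ^ c) (wtWord (lettersAbove c t))
  termination_by w => w.length
  decreasing_by
  · exact Nat.lt_succ_of_le (length_lettersBelow_le c t)
  · exact Nat.lt_succ_of_le (length_lettersAbove_le c t)

/-- The disjoint union `⨆ₙ 𝔖_n` of all symmetric groups. `Fin n` stands for `{1, …, n}` through
`i ↦ i + 1`. -/
abbrev AllPerm : Type := Σ n : ℕ, Equiv.Perm (Fin n)

/-- The one-line word `(w(1), …, w(n))` of a permutation `w`, with letters in `{1, …, n}`. -/
def oneLine (w : AllPerm) : List ℕ := List.ofFn (fun i : Fin w.1 => (w.2 i : ℕ) + 1)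

/-- The weight `wt(w)` of a permutation. -/
def wt (w : AllPerm) : RatFun := wtWord (oneLine w)

/-! ### The algebra `FQSym` -/

/-- `w` is a shuffle of the words `a = (a₁, …, a_k)` and `F^k(b) = (b₁ + k, …, b_ℓ + k)`: the two
words have no letter in common, so this says that `a` and `F^k(b)` are the subwords of `w` formed
by its letters `≤ k` and `> k`. -/
def IsShuffle (a b w : AllPerm) : Prop :=
  (oneLine w).filter (fun v => v ≤ a.1) = oneLine a ∧
    (oneLine w).filter (fun v => a.1 < v) = (oneLine b).map (fun v => v + a.1)

open Classical in
/-- All shuffles in `𝔖_{k+ℓ}` of `a ∈ 𝔖_k` and `F^k(b)`, `b ∈ 𝔖_ℓ`. -/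
def shuffles (a b : AllPerm) : Finset AllPerm :=
  ((univ : Finset (Equiv.Perm (Fin (a.1 + b.1)))).image (fun w => (⟨a.1 + b.1, w⟩ : AllPerm))).filter
    (fun w => IsShuffle a b w)

/-- The vector space of free quasisymmetric functions, with basis `𝐅_w` indexed by all
permutations `w`. -/
def FQSym : Type := AllPerm →₀ ℚ

namespace FQSym

instance : AddCommGroup FQSym := inferInstanceAs (AddCommGroup (AllPerm →₀ ℚ))

instance : Module ℚ FQSym := inferInstanceAs (Module ℚ (AllPerm →₀ ℚ))

/-- The basis `(𝐅_w)` of `FQSym`. -/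
def basis : Module.Basis AllPerm ℚ FQSym := Module.Basis.ofRepr (LinearEquiv.refl ℚ (AllPerm →₀ ℚ))

/-- The basis element `𝐅_w`. -/
def F (w : AllPerm) : FQSym := basis w

/-- The bilinear multiplication with `𝐅_a · 𝐅_b = ∑ 𝐅_w` over all shuffles `w` of `a` and
`F^k(b)`. -/
def mulHom : FQSym →ₗ[ℚ] FQSym →ₗ[ℚ] FQSym :=
  basis.constr ℚ (fun a => basis.constr ℚ (fun b => ∑ w ∈ shuffles a b, F w))

instance : Mul FQSym := ⟨fun x y => mulHom x y⟩

/-- The unit is `𝐅_e` for the permutation `e` in `𝔖_0`. -/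
instance : One FQSym := ⟨F ⟨0, 1⟩⟩

theorem mul_def (x y : FQSym) : x * y = mulHom x y := rfl

theorem one_def : (1 : FQSym) = F ⟨0, 1⟩ := rfl

theorem F_mul_F (a b : AllPerm) : F a * F b = ∑ w ∈ shuffles a b, F w := by
  simp [mul_def, mulHom, F]

end FQSym

theorem oneLine_injective : Function.Injective oneLine := by
  rintro ⟨n, v⟩ ⟨m, w⟩ h
  obtain rfl : n = m := by simpa [oneLine] using congrArg List.length h
  have h2 := List.ofFn_injective h
  congr 1
  ext i
  simpa using congrFun h2 i

theorem mem_oneLine (w : AllPerm) (v : ℕ) : v ∈ oneLine w ↔ 1 ≤ v ∧ v ≤ w.1 := by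
  obtain ⟨n, w⟩ := w
  simp only [oneLine, List.mem_ofFn]
  constructor
  · rintro ⟨i, rfl⟩
    exact ⟨by omega, (w i).2⟩
  · rintro ⟨h1, h2⟩
    exact ⟨w.symm ⟨v - 1, by omega⟩, by simp; omega⟩

theorem nodup_oneLine (w : AllPerm) : (oneLine w).Nodup := by
  obtain ⟨n, w⟩ := w
  rw [oneLine, List.nodup_ofFn]
  intro i j h
  exact w.injective (Fin.ext (by simpa using h))

theorem length_oneLine (w : AllPerm) : (oneLine w).length = w.1 := by simp [oneLine]

theorem exists_oneLine (l : List ℕ) (n : ℕ) (hl : l.Nodup) (hm : ∀ v, v ∈ l ↔ 1 ≤ v ∧ v ≤ n) :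
    ∃ w : Equiv.Perm (Fin n), oneLine ⟨n, w⟩ = l := by
  have hlen : l.length = n := by
    have : l.toFinset = Finset.Icc 1 n := by ext v; simp [hm]
    rw [← List.toFinset_card_of_nodup hl, this]; simp
  subst hlen
  have hb : ∀ i : Fin l.length, 1 ≤ l[i] ∧ l[i] ≤ l.length :=
    fun i => (hm _).1 (List.getElem_mem _)
  let f : Fin l.length → Fin l.length := fun i => ⟨l[i] - 1, by have := hb i; omega⟩
  have hf : Function.Injective f := by
    intro i j h
    have h1 : l[i] - 1 = l[j] - 1 := congrArg Fin.val h
    have h2 : l[i] = l[j] := by have := hb i; have := hb j; omega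
    exact Fin.ext ((hl.getElem_inj_iff).1 h2)
  refine ⟨Equiv.ofBijective f ⟨hf, Finite.injective_iff_surjective.1 hf⟩, ?_⟩
  apply List.ext_getElem
  · simp [oneLine]
  · intro i h1 h2
    have := hb ⟨i, h2⟩
    simp only [Fin.getElem_fin] at this
    simp [oneLine, f]
    omega

theorem IsShuffle.size {a b w : AllPerm} (h : IsShuffle a b w) : w.1 = a.1 + b.1 := by
  have h1 := congrArg List.length h.1
  have h2 := congrArg List.length h.2
  have h3 := List.length_eq_length_filter_add (l := oneLine w) (fun v => decide (v ≤ a.1))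
  have h4 : (oneLine w).filter (fun v => !decide (v ≤ a.1)) =
      (oneLine w).filter (fun v => decide (a.1 < v)) := by
    congr 1; ext v
    rw [← decide_not, decide_eq_decide, not_le]
  rw [h4, h1, h2] at h3
  simpa [length_oneLine] using h3

theorem mem_shuffles {a b w : AllPerm} : w ∈ shuffles a b ↔ IsShuffle a b w := by
  simp only [shuffles, mem_filter, mem_image, mem_univ, true_and, and_iff_right_iff_imp]
  intro h
  obtain ⟨n, w⟩ := w
  obtain rfl : n = a.1 + b.1 := h.size
  exact ⟨w, rfl⟩

theorem exists_restrict_le (w : AllPerm) (m : ℕ) (hm : m ≤ w.1) :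
    ∃ v : Equiv.Perm (Fin m), oneLine ⟨m, v⟩ = (oneLine w).filter (fun i => i ≤ m) := by
  apply exists_oneLine
  · exact (nodup_oneLine w).filter _
  · intro v
    simp only [List.mem_filter, mem_oneLine, decide_eq_true_eq]
    omega

theorem exists_restrict_gt (w : AllPerm) (k : ℕ) :
    ∃ v : Equiv.Perm (Fin (w.1 - k)),
      (oneLine ⟨w.1 - k, v⟩).map (fun i => i + k) = (oneLine w).filter (fun i => k < i) := by
  have hback : (((oneLine w).filter (fun i => k < i)).map (fun i => i - k)).map (fun i => i + k) =
      (oneLine w).filter (fun i => k < i) := by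
    rw [List.map_map]
    conv_rhs => rw [← List.map_id ((oneLine w).filter (fun i => k < i))]
    apply List.map_congr_left
    intro i hi
    have := (List.mem_filter.1 hi).2
    simp only [decide_eq_true_eq] at this
    simp only [Function.comp, id]
    omega
  obtain ⟨v, hv⟩ := exists_oneLine (((oneLine w).filter (fun i => k < i)).map (fun i => i - k))
    (w.1 - k) (by
      apply List.Nodup.of_map (fun i => i + k)
      rw [hback]
      exact (nodup_oneLine w).filter _) (by
      intro v
      simp only [List.mem_map, List.mem_filter, mem_oneLine, decide_eq_true_eq]
      constructor
      · rintro ⟨i, hi, rfl⟩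
        omega
      · intro h
        exact ⟨v + k, by omega, by omega⟩)
  exact ⟨v, by rw [hv, hback]⟩

theorem map_add_injective (k : ℕ) : Function.Injective (List.map (fun i : ℕ => i + k)) :=
  List.map_injective_iff.2 (fun x y hxy => by simpa using hxy)

theorem filter_map_add_le (l : List ℕ) (k m : ℕ) :
    (l.filter (fun i => i ≤ m)).map (fun i => i + k) =
      (l.map (fun i => i + k)).filter (fun i => i ≤ m + k) := by
  simp [List.filter_map, Function.comp_def]

theorem filter_map_add_gt (l : List ℕ) (k m : ℕ) :
    (l.filter (fun i => m < i)).map (fun i => i + k) =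
      (l.map (fun i => i + k)).filter (fun i => m + k < i) := by
  simp [List.filter_map, Function.comp_def]

/-- Associativity of shuffles of permutations. -/
theorem shuffle_assoc (a b c w : AllPerm) :
    (∃ v, IsShuffle a b v ∧ IsShuffle v c w) ↔ ∃ v, IsShuffle b c v ∧ IsShuffle a v w := by
  constructor
  · rintro ⟨v, h1, h2⟩
    have hv := h1.size
    have hw := h2.size
    obtain ⟨v', hv'⟩ := exists_restrict_gt w a.1
    refine ⟨⟨w.1 - a.1, v'⟩, ⟨?_, ?_⟩, ⟨?_, hv'.symm⟩⟩
    · apply map_add_injective a.1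
      rw [filter_map_add_le, hv', ← h1.2, ← h2.1, List.filter_filter, List.filter_filter]
      apply List.filter_congr
      intro i _
      simp only [hv, Nat.add_comm b.1 a.1, Bool.and_comm]
    · apply map_add_injective a.1
      rw [filter_map_add_gt, hv', List.map_map, List.filter_filter]
      have : (fun i => i + a.1) ∘ (fun i => i + b.1) = (fun i : ℕ => i + v.1) := by
        funext i; simp [hv]; omega
      rw [this, ← h2.2]
      apply List.filter_congr
      intro i _
      rw [← Bool.decide_and, decide_eq_decide]
      omega
    · rw [← h1.1, ← h2.1, List.filter_filter]
      apply List.filter_congr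
      intro i _
      rw [← Bool.decide_and, decide_eq_decide]
      omega
  · rintro ⟨v, h1, h2⟩
    have hv := h1.size
    have hw := h2.size
    obtain ⟨v', hv'⟩ := exists_restrict_le w (a.1 + b.1) (by omega)
    refine ⟨⟨a.1 + b.1, v'⟩, ⟨?_, ?_⟩, ⟨hv'.symm, ?_⟩⟩
    · rw [hv', ← h2.1, List.filter_filter]
      apply List.filter_congr
      intro i _
      rw [← Bool.decide_and, decide_eq_decide]
      omega
    · rw [hv', ← h1.1, filter_map_add_le, ← h2.2, List.filter_filter, List.filter_filter]
      apply List.filter_congr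
      intro i _
      simp only [Nat.add_comm b.1 a.1, Bool.and_comm]
    · have : (fun i => i + a.1) ∘ (fun i => i + b.1) = (fun i : ℕ => i + (a.1 + b.1)) := by
        funext i; simp; omega
      rw [← this, ← List.map_map, ← h1.2, filter_map_add_gt, ← h2.2, List.filter_filter]
      apply List.filter_congr
      intro i _
      simp only
      rw [← Bool.decide_and, decide_eq_decide]
      omega

theorem shuffle_left_unique {a b c w v v' : AllPerm} (h1 : IsShuffle a b v) (h2 : IsShuffle v c w)
    (h1' : IsShuffle a b v') (h2' : IsShuffle v' c w) : v = v' := by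
  apply oneLine_injective
  rw [← h2.1, ← h2'.1, h1.size, h1'.size]

theorem shuffle_right_unique {a w v v' : AllPerm} (h : IsShuffle a v w) (h' : IsShuffle a v' w) :
    v = v' := by
  apply oneLine_injective
  have := h.2.symm.trans h'.2
  exact List.map_injective_iff.2 (fun x y hxy => by simpa using hxy) this

theorem one_shuffle (a w : AllPerm) : IsShuffle ⟨0, 1⟩ a w ↔ w = a := by
  constructor
  · intro h
    apply oneLine_injective
    have := h.2
    simp only [Nat.add_zero, List.map_id'] at this
    rw [← this, List.filter_eq_self.2]
    intro v hv
    have := ((mem_oneLine w v).1 hv).1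
    simp only [decide_eq_true_eq]
    omega
  · rintro rfl
    refine ⟨?_, ?_⟩
    · have : oneLine ⟨0, 1⟩ = [] := by simp [oneLine]
      rw [this, List.filter_eq_nil_iff]
      intro v hv
      have := ((mem_oneLine w v).1 hv).1
      simp only [decide_eq_true_eq]
      omega
    · simp only [Nat.add_zero, List.map_id']
      rw [List.filter_eq_self]
      intro v hv
      have := ((mem_oneLine w v).1 hv).1
      simp only [decide_eq_true_eq]
      omega

theorem shuffle_one (a w : AllPerm) : IsShuffle a ⟨0, 1⟩ w ↔ w = a := by
  have hnil : oneLine ⟨0, 1⟩ = [] := by simp [oneLine]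
  constructor
  · intro h
    apply oneLine_injective
    rw [← h.1, List.filter_eq_self.2]
    intro v hv
    have := ((mem_oneLine w v).1 hv).2
    have hs := h.size
    simp only [decide_eq_true_eq]
    simp only at hs
    omega
  · rintro rfl
    refine ⟨?_, ?_⟩
    · rw [List.filter_eq_self]
      intro v hv
      simpa using ((mem_oneLine w v).1 hv).2
    · rw [hnil, List.map_nil, List.filter_eq_nil_iff]
      intro v hv
      simpa using ((mem_oneLine w v).1 hv).2

namespace FQSym

theorem F_mul_assoc (a b c : AllPerm) : F a * F b * F c = F a * (F b * F c) := by
  classical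
  have hl : F a * F b * F c =
      ∑ v ∈ shuffles a b, ∑ w ∈ shuffles v c, F w := by
    rw [F_mul_F, mul_def, map_sum, LinearMap.sum_apply]
    exact Finset.sum_congr rfl (fun v _ => F_mul_F v c)
  have hr : F a * (F b * F c) =
      ∑ v ∈ shuffles b c, ∑ w ∈ shuffles a v, F w := by
    rw [F_mul_F, mul_def, map_sum]
    exact Finset.sum_congr rfl (fun v _ => F_mul_F a v)
  rw [hl, hr, ← Finset.sum_biUnion, ← Finset.sum_biUnion]
  · refine Finset.sum_congr ?_ (fun _ _ => rfl)
    ext w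
    simpa only [Finset.mem_biUnion, mem_shuffles] using shuffle_assoc a b c w
  · intro v hv v' hv' hne
    refine Finset.disjoint_left.2 (fun w hw hw' => hne ?_)
    exact shuffle_right_unique (mem_shuffles.1 hw) (mem_shuffles.1 hw')
  · intro v hv v' hv' hne
    refine Finset.disjoint_left.2 (fun w hw hw' => hne ?_)
    exact shuffle_left_unique (mem_shuffles.1 hv) (mem_shuffles.1 hw) (mem_shuffles.1 hv')
      (mem_shuffles.1 hw')

theorem one_mul_F (a : AllPerm) : 1 * F a = F a := by
  rw [one_def, F_mul_F]
  have : shuffles ⟨0, 1⟩ a = {a} := by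
    ext w
    rw [mem_shuffles, one_shuffle, Finset.mem_singleton]
  rw [this, Finset.sum_singleton]

theorem F_mul_one (a : AllPerm) : F a * 1 = F a := by
  rw [one_def, F_mul_F]
  have : shuffles a ⟨0, 1⟩ = {a} := by
    ext w
    rw [mem_shuffles, shuffle_one, Finset.mem_singleton]
  rw [this, Finset.sum_singleton]

protected theorem induct {p : FQSym → Prop} (hF : ∀ a, p (F a)) (h0 : p 0)
    (hadd : ∀ x y, p x → p y → p (x + y)) (hsmul : ∀ (r : ℚ) x, p x → p (r • x)) (x : FQSym) :
    p x := by
  have hx : x ∈ Submodule.span ℚ (Set.range F) := by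
    have : Set.range F = Set.range basis := rfl
    rw [this, basis.span_eq]
    exact Submodule.mem_top
  induction hx using Submodule.span_induction with
  | mem x h =>
    obtain ⟨a, rfl⟩ := h
    exact hF a
  | zero => exact h0
  | add x y _ _ hx hy => exact hadd x y hx hy
  | smul r x _ hx => exact hsmul r x hx

protected theorem add_mul' (x y z : FQSym) : (x + y) * z = x * z + y * z := by simp [mul_def]

protected theorem mul_add' (x y z : FQSym) : x * (y + z) = x * y + x * z := by simp [mul_def]

protected theorem zero_mul' (x : FQSym) : 0 * x = 0 := by simp [mul_def]

protected theorem mul_zero' (x : FQSym) : x * 0 = 0 := by simp [mul_def]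

protected theorem smul_mul' (r : ℚ) (x y : FQSym) : (r • x) * y = r • (x * y) := by simp [mul_def]

protected theorem mul_smul' (r : ℚ) (x y : FQSym) : x * (r • y) = r • (x * y) := by simp [mul_def]

protected theorem mul_assoc' (x y z : FQSym) : x * y * z = x * (y * z) := by
  induction x using FQSym.induct with
  | h0 => simp only [FQSym.zero_mul']
  | hadd x x' hx hx' => simp only [FQSym.add_mul', hx, hx']
  | hsmul r x hx => simp only [FQSym.smul_mul', hx]
  | hF a =>
    induction y using FQSym.induct with
    | h0 => simp only [FQSym.zero_mul', FQSym.mul_zero']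
    | hadd x x' hx hx' => simp only [FQSym.add_mul', FQSym.mul_add', hx, hx']
    | hsmul r x hx => simp only [FQSym.smul_mul', FQSym.mul_smul', hx]
    | hF b =>
      induction z using FQSym.induct with
      | h0 => simp only [FQSym.mul_zero']
      | hadd x x' hx hx' => simp only [FQSym.mul_add', hx, hx']
      | hsmul r x hx => simp only [FQSym.mul_smul', hx]
      | hF c => exact F_mul_assoc a b c

/-- The ring structure of `FQSym`. -/
instance : Ring FQSym where
  __ := (inferInstance : AddCommGroup FQSym)
  left_distrib := FQSym.mul_add'
  right_distrib := FQSym.add_mul'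
  zero_mul := FQSym.zero_mul'
  mul_zero := FQSym.mul_zero'
  mul_assoc := FQSym.mul_assoc'
  one_mul x := by
    induction x using FQSym.induct with
    | h0 => exact FQSym.mul_zero' 1
    | hadd x x' hx hx' => rw [FQSym.mul_add', hx, hx']
    | hsmul r x hx => rw [FQSym.mul_smul', hx]
    | hF a => exact one_mul_F a
  mul_one x := by
    induction x using FQSym.induct with
    | h0 => exact FQSym.zero_mul' 1
    | hadd x x' hx hx' => rw [FQSym.add_mul', hx, hx']
    | hsmul r x hx => rw [FQSym.smul_mul', hx]
    | hF a => exact F_mul_one a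

/-- The `ℚ`-algebra structure of `FQSym`. -/
instance : Algebra ℚ FQSym := Algebra.ofModule FQSym.smul_mul' (fun r x y => FQSym.mul_smul' r x y)

end FQSym

/-! ### Recursively labelled forests and the subspace `PBT`

A poset on `{1, …, n}` is an arbitrary partial order `P` on `Fin n`, with relations `P.le`, `P.lt`;
the usual order of the labels is the order of the natural numbers `(i : ℕ)`. -/

/-- A forest poset: every element covers at most one other element. -/
def IsForest {n : ℕ} (P : PartialOrder (Fin n)) : Prop :=
  ∀ i j j' : Fin n, @CovBy (Fin n) P.toLT j i → @CovBy (Fin n) P.toLT j' i → j = j'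

/-- `P` is recursively labelled: the set of labels of each subtree `P_{≥ i}` is an interval
`{a, a + 1, …, b}` of integers. -/
def IsRecursivelyLabelled {n : ℕ} (P : PartialOrder (Fin n)) : Prop :=
  ∀ i : Fin n, ∃ a b : ℕ, ∀ j : Fin n, P.le i j ↔ a ≤ (j : ℕ) ∧ (j : ℕ) ≤ b

open Classical in
/-- The set `𝓛(P)` of linear extensions of `P`: the permutations `w` such that `i <_P j` implies
that the letter `i` comes before the letter `j` in the word of `w`. The position of the letter `i`
is `w⁻¹(i)`. -/
def linearExtensions {n : ℕ} (P : PartialOrder (Fin n)) : Finset (Equiv.Perm (Fin n)) :=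
  univ.filter (fun w => ∀ i j : Fin n, P.lt i j → (w.symm i : ℕ) < (w.symm j : ℕ))

/-- `𝐅_P = ∑ 𝐅_w` over the linear extensions `w` of `P`. -/
def FQSym.FPoset {n : ℕ} (P : PartialOrder (Fin n)) : FQSym :=
  ∑ w ∈ linearExtensions P, FQSym.F ⟨n, w⟩

/-- The Loday–Ronco space `PBT`, spanned by the `𝐅_P` over all recursively labelled forests `P`. -/
def PBT : Submodule ℚ FQSym :=
  Submodule.span ℚ {x | ∃ (n : ℕ) (P : PartialOrder (Fin n)),
    IsForest P ∧ IsRecursivelyLabelled P ∧ x = FQSym.FPoset P}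

/-! ### The skew semigroup algebra and the map `φ_inv` -/

/-- The semigroup `{1, F, F², …}` acts on `ℚ(x₁, x₂, …)` through the Frobenius map. -/
instance frobAction : MulSemiringAction (Multiplicative ℕ) RatFun :=
  MulSemiringAction.compHom RatFun (powersHom (RatFun →+* RatFun) frob)

theorem frobAction_smul (k : ℕ) (f : RatFun) : Multiplicative.ofAdd k • f = (frob ^ k) f := rfl

instance frobAction_smulCommClass : SMulCommClass (Multiplicative ℕ) ℚ RatFun where
  smul_comm k r f := by
    rw [Algebra.smul_def, Algebra.smul_def, smul_mul']
    congr 1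
    exact map_ratCast (frob ^ k.toAdd) r

/-- The skew semigroup algebra `ℚ(x₁, x₂, …)#ℕ`: the free module over `ℚ(x₁, x₂, …)` with basis
`1, u, u², …`, and with the multiplication `f u^k · g u^ℓ = f F^k(g) u^{k+ℓ}`. -/
abbrev SkewAlg : Type := SkewMonoidAlgebra RatFun (Multiplicative ℕ)

/-- The element `f u^k` of the skew semigroup algebra. -/
def monomialU (f : RatFun) (k : ℕ) : SkewAlg := SkewMonoidAlgebra.single (Multiplicative.ofAdd k) f

theorem monomialU_mul (f g : RatFun) (k l : ℕ) :
    monomialU f k * monomialU g l = monomialU (f * (frob ^ k) g) (k + l) := by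
  rw [monomialU, monomialU, SkewMonoidAlgebra.single_mul_single]
  rfl

/-- The divided power `u^{(n)} = (1 / [n]!) u^n`. -/
def dividedU (n : ℕ) : SkewAlg := monomialU (1 / bracketFactorial n) n

/-- The `ℚ`-linear map `φ_inv : FQSym → ℚ(x₁, x₂, …)#ℕ` with `𝐅_w ↦ wt(w) u^{(n)}` for `w ∈ 𝔖_n`. -/
def phiInv : FQSym →ₗ[ℚ] SkewAlg :=
  FQSym.basis.constr ℚ (fun w => wt w • dividedU w.1)

/-- The permutation `1 ∈ 𝔖_1`. -/
def perm1 : AllPerm := ⟨1, 1⟩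

/-- The permutation `213 ∈ 𝔖_3`. -/
def perm213 : AllPerm := ⟨3, Equiv.swap 0 1⟩

end

/-! Multiplicativity on `PBT` comes from a multivariate hook formula. For a recursively labelled
forest `P` on n labels, the weights of its linear extensions sum to [n]!/H(P), where H(P) is the
product over subtrees, with least label a and size h, of F^{a-1}[h] (`IsLaminar.sum_wtWord`). The
factor 1/[n]! in the divided power cancels, so 𝐅_P is sent to (1/H(P)) u^n. The product 𝐅_P · 𝐅_Q is
𝐅 of the disjoint union, with the labels of Q shifted by n (`IsLaminar.FPoset_mul_FPoset`). The
shift turns H into H(P) · F^n(H(Q)) (`hookProduct_concat`), which is exactly the twist in the skew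
multiplication.

The hook formula is proved by induction on n, sorting linear extensions by their first letter r, a
root. No other subtree contains r, so deleting r leaves one forest on the labels below r and one on
those above, and the rest of the word is an arbitrary shuffle of linear extensions of these two. The
recursive weight follows the same decomposition. Summing its set factor over all shuffles is a
binomial theorem (`sum_positionWeight_wordShuffles`), whose Pascal rule is [k + l] = [k] + F^k[l].
The contribution of r is then F([n-1]!)/H(P) times the hook factor of r. The root intervals
partition {1, …, n}, so these hook factors add up to [n] (`IsLaminar.sum_roots`).

For 1 and 213 there are only four shuffles. Their weights are computed explicitly, and equality
would force x₂² = x₁x₃. -/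

/-! ### Frobenius powers, brackets and factorials -/

theorem frob_pow_succ_apply (k : ℕ) (f : RatFun) : (frob ^ (k + 1)) f = (frob ^ k) (frob f) := by
  rw [pow_succ]; rfl

theorem frob_pow_succ_apply' (k : ℕ) (f : RatFun) : (frob ^ (k + 1)) f = frob ((frob ^ k) f) := by
  rw [pow_succ']; rfl

theorem frob_pow_add_apply (k l : ℕ) (f : RatFun) :
    (frob ^ (k + l)) f = (frob ^ k) ((frob ^ l) f) := by
  rw [pow_add]; rfl

theorem frob_pow_zero_apply (f : RatFun) : (frob ^ 0) f = f := rfl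

theorem frob_pow_xvar (k i : ℕ) : (frob ^ k) (xvar i) = xvar (i + k) := by
  induction k generalizing i with
  | zero => rfl
  | succ k ih => rw [frob_pow_succ_apply, frob_xvar, ih]; congr 1; omega

theorem bracket_eq_algebraMap (n : ℕ) :
    bracket n = algebraMap (MvPolynomial ℕ ℚ) RatFun (∑ i ∈ range n, MvPolynomial.X i) := by
  rw [map_sum]; rfl

theorem bracket_ne_zero {n : ℕ} (hn : n ≠ 0) : bracket n ≠ 0 := by
  rw [bracket_eq_algebraMap, Ne, IsFractionRing.to_map_eq_zero_iff]
  intro h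
  have := congrArg (MvPolynomial.eval (fun _ => (1 : ℚ))) h
  simp at this
  exact hn this

theorem bracketFactorial_ne_zero (n : ℕ) : bracketFactorial n ≠ 0 := by
  induction n with
  | zero => exact one_ne_zero
  | succ n ih =>
    exact mul_ne_zero (bracket_ne_zero n.succ_ne_zero) ((map_ne_zero frob).2 ih)

theorem bracket_add (k l : ℕ) : bracket (k + l) = bracket k + (frob ^ k) (bracket l) := by
  rw [bracket, sum_range_add, bracket, bracket, map_sum]
  congr 1
  exact sum_congr rfl fun i _ => by rw [frob_pow_xvar, Nat.add_comm]

theorem frob_pow_bracket (k h : ℕ) : (frob ^ k) (bracket h) = ∑ i ∈ Ico k (k + h), xvar i := by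
  rw [bracket, map_sum, sum_Ico_eq_sum_range, Nat.add_sub_cancel_left]
  exact sum_congr rfl fun i _ => by rw [frob_pow_xvar, Nat.add_comm]

theorem frob_pow_bracketFactorial_succ (k l : ℕ) :
    (frob ^ k) (bracketFactorial (l + 1)) =
      (frob ^ k) (bracket (l + 1)) * (frob ^ (k + 1)) (bracketFactorial l) := by
  rw [bracketFactorial, map_mul, frob_pow_succ_apply]

/-! ### Set weights computed along a word -/

/-- The numerator of `wtSet (positionsBelow c w)`, computed letter by letter. -/
noncomputable def positionWeight (c : ℕ) : List ℕ → RatFun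
  | [] => 1
  | x :: t => (if x < c then bracket ((t.filter (fun v => v < c)).length + 1) else 1) *
      frob (positionWeight c t)

theorem positionsBelow_cons (c x : ℕ) (t : List ℕ) :
    positionsBelow c (x :: t) =
      if x < c then insert 1 ((positionsBelow c t).image (· + 1))
      else (positionsBelow c t).image (· + 1) := by
  ext i
  rcases i with _ | _ | i <;> split_ifs with h <;>
    simp [positionsBelow, h]

theorem one_notMem_image_positionsBelow (c : ℕ) (t : List ℕ) :
    1 ∉ (positionsBelow c t).image (· + 1) := by
  simp [positionsBelow]

theorem card_positionsBelow (c : ℕ) (w : List ℕ) :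
    (positionsBelow c w).card = (w.filter (fun v => v < c)).length := by
  induction w with
  | nil => rfl
  | cons x t ih =>
    rw [positionsBelow_cons]
    split_ifs with h
    · rw [List.filter_cons_of_pos (by simpa using h),
        card_insert_of_notMem (one_notMem_image_positionsBelow c t),
        card_image_of_injective _ (add_left_injective 1), ih, List.length_cons]
    · rw [List.filter_cons_of_neg (by simpa using h),
        card_image_of_injective _ (add_left_injective 1), ih]

/-- Ranks are counted from the right, so prepending a letter to a word shifts the old positions
without changing their ranks. Here `T` is the new position set, which may or may not contain 1; `hT`
records that the ranks agree. -/
theorem prod_image_succ_positions (S : Finset ℕ) (hS : ∀ i ∈ S, 1 ≤ i) (T : Finset ℕ)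
    (hT : ∀ i, i ∈ S → T.filter (fun i' => i + 1 ≤ i') =
      (S.filter (fun i' => i ≤ i')).image (· + 1)) :
    ∏ i ∈ S.image (· + 1), (frob ^ (i - 1)) (bracket (T.filter (fun i' => i ≤ i')).card) =
      frob (∏ i ∈ S, (frob ^ (i - 1)) (bracket (S.filter (fun i' => i ≤ i')).card)) := by
  rw [prod_image (fun _ _ _ _ h => Nat.succ_injective h), map_prod]
  refine prod_congr rfl fun i hi => ?_
  rw [hT i hi, card_image_of_injective _ (add_left_injective 1), ← frob_pow_succ_apply']
  have := hS i hi
  congr 2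
  omega

theorem one_le_of_mem_positionsBelow {c i : ℕ} {w : List ℕ} (h : i ∈ positionsBelow c w) :
    1 ≤ i := by
  simp only [positionsBelow, mem_image] at h
  obtain ⟨p, -, rfl⟩ := h
  omega

theorem prod_positionsBelow (c : ℕ) (w : List ℕ) :
    ∏ i ∈ positionsBelow c w, (frob ^ (i - 1))
      (bracket ((positionsBelow c w).filter (fun i' => i ≤ i')).card) = positionWeight c w := by
  induction w with
  | nil => rfl
  | cons x t ih =>
    have hpos : ∀ i ∈ positionsBelow c t, 1 ≤ i := fun i => one_le_of_mem_positionsBelow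
    have key : ∀ i ∈ positionsBelow c t,
        ((positionsBelow c t).image (· + 1)).filter (fun i' => i + 1 ≤ i') =
          ((positionsBelow c t).filter (fun i' => i ≤ i')).image (· + 1) := by
      intro i _
      ext j
      simp only [mem_filter, mem_image]
      constructor
      · rintro ⟨⟨a, ha, rfl⟩, h⟩
        exact ⟨a, ⟨ha, by omega⟩, rfl⟩
      · rintro ⟨a, ⟨ha, h⟩, rfl⟩
        exact ⟨⟨a, ha, rfl⟩, by omega⟩
    rw [positionsBelow_cons, positionWeight, ← ih]
    split_ifs with h
    · rw [prod_insert (one_notMem_image_positionsBelow c t), prod_image_succ_positions _ hpos]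
      · congr 1
        -- All positions are at least 1, so the new position 1 has the largest rank, namely the size
        -- of the whole set.
        rw [Nat.sub_self, frob_pow_zero_apply, filter_true_of_mem,
          card_insert_of_notMem (one_notMem_image_positionsBelow c t),
          card_image_of_injective _ (add_left_injective 1), card_positionsBelow]
        intro i hi
        rcases mem_insert.1 hi with rfl | hi
        · exact le_rfl
        · obtain ⟨a, -, rfl⟩ := mem_image.1 hi
          omega
      · intro i hi
        rw [filter_insert, if_neg (by have := hpos i hi; omega), key i hi]
    · rw [one_mul, prod_image_succ_positions _ hpos _ key]

theorem wtSet_positionsBelow (c : ℕ) (w : List ℕ) :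
    wtSet (positionsBelow c w) =
      positionWeight c w / bracketFactorial (w.filter (fun v => v < c)).length := by
  rw [wtSet, prod_positionsBelow, card_positionsBelow]

theorem wtWord_nil : wtWord [] = 1 := by rw [wtWord]

/-- The first letter is not below itself, so position 1 contributes nothing and the numerator is a
Frobenius shift of that of the tail. -/
theorem wtWord_cons (c : ℕ) (t : List ℕ) :
    wtWord (c :: t) = frob (positionWeight c t) / bracketFactorial (lettersBelow c t).length *
      wtWord (lettersBelow c t) * (frob ^ c) (wtWord (lettersAbove c t)) := by
  rw [wtWord, wtSet_positionsBelow, positionWeight, if_neg (lt_irrefl c), one_mul,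
    List.filter_cons_of_neg (by simp)]
  rfl

/-! ### Shuffles of words and the binomial theorem -/

/-- All words whose letters satisfying `p` spell `a`, while the other letters spell `b`. -/
def wordShuffles : List ℕ → List ℕ → Finset (List ℕ)
  | [], b => {b}
  | x :: a, [] => {x :: a}
  | x :: a, y :: b =>
      (wordShuffles a (y :: b)).image (x :: ·) ∪ (wordShuffles (x :: a) b).image (y :: ·)
  termination_by a b => a.length + b.length

theorem wordShuffles_nil_left (b : List ℕ) : wordShuffles [] b = {b} := by rw [wordShuffles]

theorem wordShuffles_nil_right (a : List ℕ) : wordShuffles a [] = {a} := by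
  cases a <;> rw [wordShuffles]

/-- When `p` separates the two alphabets, the first letter of a shuffle reveals which word it came
from. This links the recursion, suited to induction on sums, with the description by filters used in
`IsShuffle`. -/
theorem mem_wordShuffles (p : ℕ → Prop) [DecidablePred p] (t a b : List ℕ)
    (ha : ∀ x ∈ a, p x) (hb : ∀ x ∈ b, ¬ p x) :
    t ∈ wordShuffles a b ↔ t.filter p = a ∧ t.filter (fun x => ¬ p x) = b := by
  induction t generalizing a b with
  | nil =>
    rcases a with _ | ⟨x, a⟩
    · rw [wordShuffles_nil_left]; simp
    · rcases b with _ | ⟨y, b⟩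
      · rw [wordShuffles_nil_right]; simp
      · rw [wordShuffles]; simp
  | cons z t ih =>
    by_cases hz : p z
    · rw [List.filter_cons_of_pos (by simpa using hz), List.filter_cons_of_neg (by simpa using hz)]
      rcases a with _ | ⟨x, a⟩
      · rw [wordShuffles_nil_left]
        simp only [mem_singleton, reduceCtorEq, false_and, iff_false]
        rintro rfl
        exact hb z List.mem_cons_self hz
      · have ih' := ih a b (fun v hv => ha v (List.mem_cons_of_mem _ hv)) hb
        rw [List.cons.injEq, and_assoc, ← ih']
        rcases b with _ | ⟨y, b⟩
        · simp [wordShuffles_nil_right]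
        · have hy : y ≠ z := fun h => hb y List.mem_cons_self (h ▸ hz)
          rw [wordShuffles]
          simp only [mem_union, mem_image, List.cons.injEq, hy, false_and, and_false, exists_false,
            or_false]
          constructor
          · rintro ⟨_, h1, h2, rfl⟩; exact ⟨h2.symm, h1⟩
          · rintro ⟨rfl, h⟩; exact ⟨_, h, rfl, rfl⟩
    · rw [List.filter_cons_of_neg (by simpa using hz), List.filter_cons_of_pos (by simpa using hz)]
      rcases b with _ | ⟨y, b⟩
      · rw [wordShuffles_nil_right]
        simp only [mem_singleton, reduceCtorEq, and_false, iff_false]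
        rintro rfl
        exact hz (ha z List.mem_cons_self)
      · have ih' := ih a b ha (fun v hv => hb v (List.mem_cons_of_mem _ hv))
        rw [List.cons.injEq, and_left_comm, ← ih']
        rcases a with _ | ⟨x, a⟩
        · simp [wordShuffles_nil_left]
        · have hx : x ≠ z := fun h => hz (h ▸ ha x List.mem_cons_self)
          rw [wordShuffles]
          simp only [mem_union, mem_image, List.cons.injEq, hx, false_and, and_false, exists_false,
            false_or]
          constructor
          · rintro ⟨_, h1, h2, rfl⟩; exact ⟨h2.symm, h1⟩
          · rintro ⟨rfl, h⟩; exact ⟨_, h, rfl, rfl⟩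

theorem filter_eq_of_mem_wordShuffles {c : ℕ} {t a b : List ℕ} (ha : ∀ x ∈ a, x < c)
    (hb : ∀ x ∈ b, ¬ x < c) (h : t ∈ wordShuffles a b) : t.filter (fun v => v < c) = a :=
  ((mem_wordShuffles (· < c) t a b ha hb).1 h).1

theorem positionWeight_of_forall_not_lt {c : ℕ} {b : List ℕ} (hb : ∀ x ∈ b, ¬ x < c) :
    positionWeight c b = 1 := by
  induction b with
  | nil => rfl
  | cons y b ih =>
    rw [positionWeight, if_neg (hb y List.mem_cons_self),
      ih (fun v hv => hb v (List.mem_cons_of_mem _ hv)), map_one, one_mul]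

theorem positionWeight_of_forall_lt {c : ℕ} {a : List ℕ} (ha : ∀ x ∈ a, x < c) :
    positionWeight c a = bracketFactorial a.length := by
  induction a with
  | nil => rfl
  | cons x a ih =>
    rw [positionWeight, if_pos (ha x List.mem_cons_self),
      ih (fun v hv => ha v (List.mem_cons_of_mem _ hv)), List.filter_eq_self.2, List.length_cons,
      bracketFactorial]
    intro v hv
    simpa using ha v (List.mem_cons_of_mem _ hv)

/-- The binomial theorem for the weights of sets, with sets encoded by shuffles of two words. -/
theorem sum_positionWeight_wordShuffles (c : ℕ) (a b : List ℕ) (ha : ∀ x ∈ a, x < c)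
    (hb : ∀ x ∈ b, ¬ x < c) :
    ∑ t ∈ wordShuffles a b, positionWeight c t =
      bracketFactorial (a.length + b.length) / (frob ^ a.length) (bracketFactorial b.length) := by
  match a, b, ha, hb with
  | [], b, ha, hb =>
    rw [wordShuffles_nil_left, sum_singleton, positionWeight_of_forall_not_lt hb, List.length_nil,
      Nat.zero_add, frob_pow_zero_apply, div_self (bracketFactorial_ne_zero _)]
  | x :: a, [], ha, hb =>
    rw [wordShuffles_nil_right, sum_singleton, positionWeight_of_forall_lt ha, List.length_nil,
      Nat.add_zero, bracketFactorial, map_one, div_one]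
  | x :: a, y :: b, ha, hb =>
    have ha' : ∀ v ∈ a, v < c := fun v hv => ha v (List.mem_cons_of_mem _ hv)
    have hb' : ∀ v ∈ b, ¬ v < c := fun v hv => hb v (List.mem_cons_of_mem _ hv)
    have hx := ha x List.mem_cons_self
    have hy := hb y List.mem_cons_self
    have h1 := sum_positionWeight_wordShuffles c a (y :: b) ha' hb
    have h2 := sum_positionWeight_wordShuffles c (x :: a) b ha hb'
    rw [wordShuffles, sum_union, sum_image (fun _ _ _ _ h => (List.cons.inj h).2),
      sum_image (fun _ _ _ _ h => (List.cons.inj h).2)]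
    · have e1 : ∀ t ∈ wordShuffles a (y :: b), positionWeight c (x :: t) =
          bracket (a.length + 1) * frob (positionWeight c t) := by
        intro t ht
        rw [positionWeight, if_pos hx, filter_eq_of_mem_wordShuffles ha' hb ht]
      have e2 : ∀ t ∈ wordShuffles (x :: a) b, positionWeight c (y :: t) =
          frob (positionWeight c t) := by
        intro t _
        rw [positionWeight, if_neg hy, one_mul]
      rw [sum_congr rfl e1, sum_congr rfl e2, ← mul_sum, ← map_sum, ← map_sum, h1, h2]
      simp only [List.length_cons, map_div₀, ← frob_pow_succ_apply']
      have hl : a.length + 1 + (b.length + 1) = (a.length + (b.length + 1)) + 1 := by omega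
      have hl' : a.length + 1 + b.length = a.length + (b.length + 1) := by omega
      -- Pascal's rule: the first summand on the right comes from the shuffles starting in the first
      -- word, the second from those starting in the second.
      have hbr : bracket (a.length + (b.length + 1) + 1) =
          bracket (a.length + 1) + (frob ^ (a.length + 1)) (bracket (b.length + 1)) := by
        rw [← bracket_add]; congr 1; omega
      rw [hl, hl', frob_pow_bracketFactorial_succ, bracketFactorial, hbr]
      have n1 : (frob ^ (a.length + 1)) (bracket (b.length + 1)) ≠ 0 :=
        (map_ne_zero _).2 (bracket_ne_zero (Nat.succ_ne_zero _))
      have n2 : (frob ^ (a.length + 1 + 1)) (bracketFactorial b.length) ≠ 0 :=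
        (map_ne_zero _).2 (bracketFactorial_ne_zero _)
      field_simp
    · refine disjoint_left.2 fun t h h' => ?_
      obtain ⟨s, -, rfl⟩ := mem_image.1 h
      obtain ⟨s', -, h'⟩ := mem_image.1 h'
      have := (List.cons.inj h').1
      omega
  termination_by a.length + b.length

/-! ### Forests as laminar families of intervals -/

/-- The hypothesis settles all pairs with exactly one member in `p`, so the condition decouples. It
is applied when the order has no relations between the two classes of letters. -/
theorem List.pairwise_iff_pairwise_filter {R : ℕ → ℕ → Prop} (p : ℕ → Prop) [DecidablePred p]
    {l : List ℕ} (h : ∀ x ∈ l, ∀ y ∈ l, (p x ↔ ¬ p y) → R x y) :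
    l.Pairwise R ↔
      (l.filter p).Pairwise R ∧ (l.filter (fun x => ¬ p x)).Pairwise R := by
  induction l with
  | nil => simp
  | cons z t ih =>
    have ih' := ih fun x hx y hy =>
      h x (List.mem_cons_of_mem _ hx) y (List.mem_cons_of_mem _ hy)
    have hz : ∀ y ∈ t, (p z ↔ ¬ p y) → R z y := fun y hy =>
      h z List.mem_cons_self y (List.mem_cons_of_mem _ hy)
    by_cases hp : p z
    · rw [List.filter_cons_of_pos (by simpa using hp), List.filter_cons_of_neg (by simpa using hp),
        List.pairwise_cons, List.pairwise_cons, ih', and_assoc]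
      refine and_congr_left fun _ => ⟨fun H y hy => H y (List.mem_of_mem_filter hy),
        fun H y hy => ?_⟩
      by_cases hy' : p y
      · exact H y (List.mem_filter.2 ⟨hy, by simpa using hy'⟩)
      · exact hz y hy (by tauto)
    · rw [List.filter_cons_of_neg (by simpa using hp), List.filter_cons_of_pos (by simpa using hp),
        List.pairwise_cons, List.pairwise_cons, ih', and_left_comm]
      refine and_congr_right fun _ => and_congr_left fun _ =>
        ⟨fun H y hy => H y (List.mem_of_mem_filter hy), fun H y hy => ?_⟩
      by_cases hy' : p y
      · exact hz y hy (by tauto)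
      · exact H y (List.mem_filter.2 ⟨hy, by simpa using hy'⟩)

/-- The intervals `[lo v, hi v]`, for `1 ≤ v ≤ n`, are the principal filters of a recursively
labelled forest on `{1, …, n}`. -/
structure IsLaminar (n : ℕ) (lo hi : ℕ → ℕ) : Prop where
  one_le : ∀ v, 1 ≤ v → v ≤ n → 1 ≤ lo v
  lo_le : ∀ v, 1 ≤ v → v ≤ n → lo v ≤ v
  le_hi : ∀ v, 1 ≤ v → v ≤ n → v ≤ hi v
  hi_le : ∀ v, 1 ≤ v → v ≤ n → hi v ≤ n
  nested : ∀ i j, 1 ≤ i → i ≤ n → 1 ≤ j → j ≤ n → lo i ≤ j → j ≤ hi i →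
    lo i ≤ lo j ∧ hi j ≤ hi i
  antisymm : ∀ i j, 1 ≤ i → i ≤ n → 1 ≤ j → j ≤ n → lo i ≤ j → j ≤ hi i → lo j ≤ i → i ≤ hi j →
    i = j
  comparable : ∀ i j k, 1 ≤ i → i ≤ n → 1 ≤ j → j ≤ n → lo i ≤ k → k ≤ hi i → lo j ≤ k → k ≤ hi j →
    (lo i ≤ j ∧ j ≤ hi i) ∨ (lo j ≤ i ∧ i ≤ hi j)

/-- The words on the letters `1, …, n` in which `y` precedes every other letter of
`[lo y, hi y]`. -/
def forestWords (n : ℕ) (lo hi : ℕ → ℕ) : Finset (List ℕ) :=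
  (List.range' 1 n).permutations.toFinset.filter
    (fun l => l.Pairwise (fun x y => ¬ (lo y ≤ x ∧ x ≤ hi y)))

theorem mem_forestWords {n : ℕ} {lo hi : ℕ → ℕ} {l : List ℕ} :
    l ∈ forestWords n lo hi ↔ l.Nodup ∧ (∀ v, v ∈ l ↔ 1 ≤ v ∧ v ≤ n) ∧
      l.Pairwise (fun x y => ¬ (lo y ≤ x ∧ x ≤ hi y)) := by
  rw [forestWords, mem_filter, List.mem_toFinset, List.mem_permutations, ← and_assoc]
  refine and_congr_left fun _ => ?_
  have hr : ∀ v, v ∈ List.range' 1 n ↔ 1 ≤ v ∧ v ≤ n := by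
    intro v
    rw [List.mem_range'_1]
    omega
  constructor
  · intro h
    exact ⟨h.nodup_iff.2 List.nodup_range', fun v => by rw [h.mem_iff, hr]⟩
  · rintro ⟨h1, h2⟩
    exact (List.perm_ext_iff_of_nodup h1 List.nodup_range').2 fun v => by rw [h2, hr]

theorem length_of_mem_forestWords {n : ℕ} {lo hi : ℕ → ℕ} {l : List ℕ}
    (h : l ∈ forestWords n lo hi) : l.length = n := by
  rw [forestWords, mem_filter, List.mem_toFinset, List.mem_permutations] at h
  rw [h.1.length_eq, List.length_range']

open Classical in
/-- The minimal elements of a recursively labelled forest. -/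
noncomputable def forestRoots (n : ℕ) (lo hi : ℕ → ℕ) : Finset ℕ :=
  (Icc 1 n).filter (fun r => ∀ v ∈ Icc 1 n, v ≠ r → ¬ (lo v ≤ r ∧ r ≤ hi v))

theorem mem_forestRoots {n r : ℕ} {lo hi : ℕ → ℕ} :
    r ∈ forestRoots n lo hi ↔ 1 ≤ r ∧ r ≤ n ∧
      ∀ v, 1 ≤ v → v ≤ n → v ≠ r → ¬ (lo v ≤ r ∧ r ≤ hi v) := by
  simp only [forestRoots, mem_filter, mem_Icc, and_assoc, and_imp]

namespace IsLaminar

variable {n r : ℕ} {lo hi : ℕ → ℕ}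

/-- The interval of `v` contains `v` but not the root `r`, so it stays on its side of `r`. With
`lt_lo`, this is why deleting a root splits the forest in two. -/
theorem hi_lt (h : IsLaminar n lo hi) (hr : r ∈ forestRoots n lo hi) (v : ℕ) (h1 : 1 ≤ v)
    (h2 : v < r) : hi v < r := by
  obtain ⟨_, h4, h5⟩ := mem_forestRoots.1 hr
  have := h5 v h1 (by omega) (by omega)
  have := h.lo_le v h1 (by omega)
  omega

theorem lt_lo (h : IsLaminar n lo hi) (hr : r ∈ forestRoots n lo hi) (v : ℕ) (h1 : r < v)
    (h2 : v ≤ n) : r < lo v := by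
  obtain ⟨_, h4, h5⟩ := mem_forestRoots.1 hr
  have := h5 v (by omega) h2 (by omega)
  have := h.le_hi v (by omega) h2
  omega

theorem restrict_below (h : IsLaminar n lo hi) (hr : r ∈ forestRoots n lo hi) :
    IsLaminar (r - 1) lo hi := by
  have hrn := (mem_forestRoots.1 hr).2.1
  have key := h.hi_lt hr
  refine ⟨fun v h1 h2 => h.one_le v h1 (by omega), fun v h1 h2 => h.lo_le v h1 (by omega),
    fun v h1 h2 => h.le_hi v h1 (by omega), fun v h1 h2 => ?_,
    fun i j h1 h2 h3 h4 => h.nested i j h1 (by omega) h3 (by omega),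
    fun i j h1 h2 h3 h4 => h.antisymm i j h1 (by omega) h3 (by omega),
    fun i j k h1 h2 h3 h4 => h.comparable i j k h1 (by omega) h3 (by omega)⟩
  have := key v h1 (by omega)
  omega

theorem restrict_above (h : IsLaminar n lo hi) (hr : r ∈ forestRoots n lo hi) :
    IsLaminar (n - r) (fun v => lo (v + r) - r) (fun v => hi (v + r) - r) := by
  -- Left endpoints of labels above `r` exceed `r`, so the truncated subtractions are exact.
  have key := h.lt_lo hr
  refine ⟨fun v h1 h2 => ?_, fun v h1 h2 => ?_, fun v h1 h2 => ?_, fun v h1 h2 => ?_,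
    fun i j h1 h2 h3 h4 h5 h6 => ?_, fun i j h1 h2 h3 h4 h5 h6 h7 h8 => ?_,
    fun i j k h1 h2 h3 h4 h5 h6 h7 h8 => ?_⟩
  · have := key (v + r) (by omega) (by omega); omega
  · have := h.lo_le (v + r) (by omega) (by omega); omega
  · have := h.le_hi (v + r) (by omega) (by omega); omega
  · have := h.hi_le (v + r) (by omega) (by omega); omega
  · have := key (i + r) (by omega) (by omega)
    have := key (j + r) (by omega) (by omega)
    have := h.nested (i + r) (j + r) (by omega) (by omega) (by omega) (by omega)
      (by omega) (by omega)
    omega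
  · have := h.antisymm (i + r) (j + r) (by omega) (by omega) (by omega) (by omega)
      (by omega) (by omega) (by omega) (by omega)
    omega
  · have := key (i + r) (by omega) (by omega)
    have := key (j + r) (by omega) (by omega)
    have := h.le_hi (i + r) (by omega) (by omega)
    have := h.le_hi (j + r) (by omega) (by omega)
    have := h.comparable (i + r) (j + r) (k + r) (by omega) (by omega) (by omega) (by omega)
      (by omega) (by omega) (by omega) (by omega)
    omega

end IsLaminar

/-! ### Splitting a linear extension at its first letter -/

theorem map_lettersAbove (r : ℕ) (t : List ℕ) :
    (lettersAbove r t).map (fun v => v + r) = t.filter (fun v => r < v) := by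
  rw [lettersAbove, List.map_map]
  conv_rhs => rw [← List.map_id (t.filter (fun v => r < v))]
  refine List.map_congr_left fun i hi => ?_
  have := (List.mem_filter.1 hi).2
  simp only [decide_eq_true_eq] at this
  simp only [Function.comp, id]
  omega

theorem lettersAbove_eq_of_filter_eq {r : ℕ} {t b : List ℕ}
    (h : t.filter (fun v => r < v) = b.map (fun v => v + r)) : lettersAbove r t = b :=
  map_add_injective r ((map_lettersAbove r t).trans h)

theorem mem_wordShuffles_lt {r : ℕ} {lo hi : ℕ → ℕ} {t a b : List ℕ}
    (ha : a ∈ forestWords (r - 1) lo hi) :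
    t ∈ wordShuffles a (b.map (fun v => v + r)) ↔
      t.filter (fun v => v < r) = a ∧ t.filter (fun v => ¬ v < r) = b.map (fun v => v + r) := by
  refine mem_wordShuffles (· < r) t _ _ (fun x hx => ?_) (fun x hx => ?_)
  · have := ((mem_forestWords.1 ha).2.1 x).1 hx
    omega
  · obtain ⟨v, -, rfl⟩ := List.mem_map.1 hx
    omega

theorem filter_not_lt_eq {r : ℕ} {t : List ℕ} (hr : r ∉ t) :
    t.filter (fun v => ¬ v < r) = t.filter (fun v => r < v) := by
  refine List.filter_congr fun v hv => decide_eq_decide.2 ?_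
  have : v ≠ r := fun h => hr (h ▸ hv)
  omega

theorem notMem_of_filter_eq {n r : ℕ} {lo hi : ℕ → ℕ} {t b : List ℕ}
    (hb : b ∈ forestWords n lo hi)
    (h : t.filter (fun v => ¬ v < r) = b.map (fun v => v + r)) : r ∉ t := by
  intro hrt
  have : r ∈ t.filter (fun v => ¬ v < r) := List.mem_filter.2 ⟨hrt, by simp⟩
  rw [h] at this
  obtain ⟨v, hv, hvr⟩ := List.mem_map.1 this
  have := ((mem_forestWords.1 hb).2.1 v).1 hv
  omega

/-- A linear extension begins with a minimal element `r`. Afterwards the interval of `r` imposes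
nothing more, and no other interval crosses `r`, so the letters below and above `r` may interleave
freely. -/
theorem IsLaminar.cons_mem_forestWords {n : ℕ} {lo hi : ℕ → ℕ} (h : IsLaminar n lo hi) (r : ℕ)
    (t : List ℕ) :
    r :: t ∈ forestWords n lo hi ↔ r ∈ forestRoots n lo hi ∧
      ∃ a ∈ forestWords (r - 1) lo hi,
      ∃ b ∈ forestWords (n - r) (fun v => lo (v + r) - r) (fun v => hi (v + r) - r),
        t ∈ wordShuffles a (b.map (fun v => v + r)) := by
  constructor
  · intro hw
    obtain ⟨h1, h2, h3⟩ := mem_forestWords.1 hw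
    obtain ⟨hrt, h1⟩ := List.nodup_cons.1 h1
    obtain ⟨hroot, h3⟩ := List.pairwise_cons.1 h3
    have hmem : ∀ v, v ∈ t ↔ 1 ≤ v ∧ v ≤ n ∧ v ≠ r := by
      intro v
      have := h2 v
      rw [List.mem_cons] at this
      constructor
      · intro hv
        exact ⟨(this.1 (Or.inr hv)).1, (this.1 (Or.inr hv)).2, fun e => hrt (e ▸ hv)⟩
      · rintro ⟨a, b, c⟩
        exact (this.2 ⟨a, b⟩).resolve_left c
    have hr := (h2 r).1 List.mem_cons_self
    have hR : r ∈ forestRoots n lo hi := mem_forestRoots.2 ⟨hr.1, hr.2, fun v a b c =>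
      hroot v ((hmem v).2 ⟨a, b, c⟩)⟩
    have ha : t.filter (fun v => v < r) ∈ forestWords (r - 1) lo hi := by
      refine mem_forestWords.2 ⟨h1.filter _, fun v => ?_, h3.filter _⟩
      rw [List.mem_filter, hmem, decide_eq_true_eq]
      omega
    have hb : lettersAbove r t ∈
        forestWords (n - r) (fun v => lo (v + r) - r) (fun v => hi (v + r) - r) := by
      have hm : ∀ v, v ∈ lettersAbove r t ↔ 1 ≤ v ∧ v ≤ n - r := by
        intro v
        rw [lettersAbove, List.mem_map]
        simp only [List.mem_filter, hmem, decide_eq_true_eq]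
        constructor
        · rintro ⟨i, hi, rfl⟩
          omega
        · intro hv
          exact ⟨v + r, by omega, by omega⟩
      refine mem_forestWords.2 ⟨?_, hm, ?_⟩
      · apply List.Nodup.of_map (fun v => v + r)
        rw [map_lettersAbove]
        exact h1.filter _
      · have h4 := h3.filter (fun v => decide (r < v))
        rw [← map_lettersAbove, List.pairwise_map] at h4
        refine h4.imp_of_mem fun {x y} hx hy hxy => ?_
        have hx' := (hm x).1 hx
        have hy' := (hm y).1 hy
        have := h.lt_lo hR (y + r) (by omega) (by omega)
        have := h.le_hi (y + r) (by omega) (by omega)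
        omega
    refine ⟨hR, _, ha, _, hb, (mem_wordShuffles_lt ha).2 ⟨rfl, ?_⟩⟩
    rw [filter_not_lt_eq hrt, map_lettersAbove]
  · rintro ⟨hR, a, ha, b, hb, ht⟩
    obtain ⟨hta, htb⟩ := (mem_wordShuffles_lt ha).1 ht
    have hrt := notMem_of_filter_eq hb htb
    obtain ⟨hr1, hrn, hroot⟩ := mem_forestRoots.1 hR
    obtain ⟨a1, a2, a3⟩ := mem_forestWords.1 ha
    obtain ⟨b1, b2, b3⟩ := mem_forestWords.1 hb
    have hmem : ∀ v, v ∈ t ↔ 1 ≤ v ∧ v ≤ n ∧ v ≠ r := by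
      intro v
      have e : v ∈ t ↔ v ∈ t.filter (fun v => v < r) ∨ v ∈ t.filter (fun v => ¬ v < r) := by
        simp only [List.mem_filter, decide_eq_true_eq, ← and_or_left, em, and_true]
      rw [e, hta, htb, a2, List.mem_map]
      simp only [b2]
      constructor
      · rintro (hv | ⟨i, hi, rfl⟩) <;> omega
      · intro hv
        rcases lt_or_gt_of_ne hv.2.2 with h' | h'
        · left; omega
        · right; exact ⟨v - r, by omega, by omega⟩
    refine mem_forestWords.2 ⟨List.nodup_cons.2 ⟨hrt, ?_⟩, fun v => ?_,
      List.pairwise_cons.2 ⟨fun v hv => ?_, ?_⟩⟩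
    -- `Nodup` is the pairwise condition for `≠`, so it splits in the same way as the order
    -- condition below.
    · refine (List.pairwise_iff_pairwise_filter (· < r) ?_).2 ⟨?_, ?_⟩
      · rintro x - y - hxy rfl
        tauto
      · rw [hta]; exact a1
      · rw [htb]; exact b1.map (add_left_injective r)
    · rw [List.mem_cons, hmem]
      omega
    · have := (hmem v).1 hv
      exact hroot v this.1 this.2.1 this.2.2
    · refine (List.pairwise_iff_pairwise_filter (· < r) ?_).2 ⟨?_, ?_⟩
      · intro x hx y hy hxy
        have hx' := (hmem x).1 hx
        have hy' := (hmem y).1 hy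
        rcases lt_or_gt_of_ne hy'.2.2 with h' | h'
        · have := h.hi_lt hR y hy'.1 h'
          omega
        · have := h.lt_lo hR y h' hy'.2.1
          omega
      · rw [hta]; exact a3
      · rw [htb, List.pairwise_map]
        refine b3.imp fun {x y} hxy => ?_
        omega

/-- The decomposition is unique: `r` is the first letter, and the tail gives back `a` and the
shifted `b` by filtering. Hence all the unions involved are disjoint. -/
theorem IsLaminar.sum_forestWords {M : Type*} [AddCommMonoid M] {n : ℕ} {lo hi : ℕ → ℕ}
    (h : IsLaminar n lo hi) (hn : n ≠ 0) (f : List ℕ → M) :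
    ∑ w ∈ forestWords n lo hi, f w = ∑ r ∈ forestRoots n lo hi,
      ∑ a ∈ forestWords (r - 1) lo hi,
      ∑ b ∈ forestWords (n - r) (fun v => lo (v + r) - r) (fun v => hi (v + r) - r),
      ∑ t ∈ wordShuffles a (b.map (fun v => v + r)), f (r :: t) := by
  classical
  have key : forestWords n lo hi = (forestRoots n lo hi).biUnion fun r =>
      (forestWords (r - 1) lo hi).biUnion fun a =>
      (forestWords (n - r) (fun v => lo (v + r) - r) (fun v => hi (v + r) - r)).biUnion fun b =>
      (wordShuffles a (b.map (fun v => v + r))).image (r :: ·) := by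
    ext w
    rcases w with _ | ⟨r, t⟩
    · have : [] ∉ forestWords n lo hi := fun hw => hn (length_of_mem_forestWords hw).symm
      simp [this]
    · rw [h.cons_mem_forestWords]
      simp only [mem_biUnion, mem_image, List.cons.injEq]
      constructor
      · rintro ⟨hr, a, ha, b, hb, ht⟩
        exact ⟨r, hr, a, ha, b, hb, t, ht, rfl, rfl⟩
      · rintro ⟨_, hr, a, ha, b, hb, _, ht, rfl, rfl⟩
        exact ⟨hr, a, ha, b, hb, ht⟩
  rw [key, sum_biUnion]
  · refine sum_congr rfl fun r _ => ?_
    rw [sum_biUnion]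
    · refine sum_congr rfl fun a ha => ?_
      rw [sum_biUnion]
      · exact sum_congr rfl fun b _ => sum_image fun _ _ _ _ e => (List.cons.inj e).2
      · intro b hb b' hb' hne
        refine disjoint_left.2 fun w hw hw' => hne ?_
        obtain ⟨t, ht, rfl⟩ := mem_image.1 hw
        obtain ⟨t', ht', e⟩ := mem_image.1 hw'
        obtain rfl := (List.cons.inj e).2
        exact map_add_injective r (((mem_wordShuffles_lt ha).1 ht).2.symm.trans
          ((mem_wordShuffles_lt ha).1 ht').2)
    · intro a ha a' ha' hne
      refine disjoint_left.2 fun w hw hw' => hne ?_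
      obtain ⟨b, hb, hw⟩ := mem_biUnion.1 hw
      obtain ⟨b', hb', hw'⟩ := mem_biUnion.1 hw'
      obtain ⟨t, ht, rfl⟩ := mem_image.1 hw
      obtain ⟨t', ht', e⟩ := mem_image.1 hw'
      obtain rfl := (List.cons.inj e).2
      exact ((mem_wordShuffles_lt ha).1 ht).1.symm.trans ((mem_wordShuffles_lt ha').1 ht').1
  · intro r hr r' hr' hne
    refine disjoint_left.2 fun w hw hw' => hne ?_
    simp only [mem_biUnion, mem_image] at hw hw'
    obtain ⟨_, _, _, _, _, _, rfl⟩ := hw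
    obtain ⟨_, _, _, _, _, _, e⟩ := hw'
    exact (List.cons.inj e).1.symm

/-! ### The hook formula -/

/-- Among the intervals containing `v`, a longest one belongs to a root `r`: if the interval of `u`
contains `r`, it contains the whole interval of `r`, hence equals it by maximality, and antisymmetry
gives `u = r`. -/
theorem IsLaminar.exists_root {n : ℕ} {lo hi : ℕ → ℕ} (h : IsLaminar n lo hi) (v : ℕ)
    (h1 : 1 ≤ v) (h2 : v ≤ n) : ∃ r ∈ forestRoots n lo hi, lo r ≤ v ∧ v ≤ hi r := by
  obtain ⟨r, hr, hmax⟩ := exists_max_image ((Icc 1 n).filter fun r => lo r ≤ v ∧ v ≤ hi r)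
    (fun r => hi r - lo r) ⟨v, by
      simp only [mem_filter, mem_Icc]
      exact ⟨⟨h1, h2⟩, h.lo_le v h1 h2, h.le_hi v h1 h2⟩⟩
  simp only [mem_filter, mem_Icc] at hr hmax
  obtain ⟨⟨hr1, hr2⟩, hr3, hr4⟩ := hr
  refine ⟨r, mem_forestRoots.2 ⟨hr1, hr2, fun u hu1 hu2 hne hu => hne ?_⟩, hr3, hr4⟩
  have e := h.nested u r hu1 hu2 hr1 hr2 hu.1 hu.2
  have := hmax u ⟨⟨hu1, hu2⟩, by omega, by omega⟩
  have := h.lo_le u hu1 hu2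
  have := h.le_hi u hu1 hu2
  have := h.lo_le r hr1 hr2
  have := h.le_hi r hr1 hr2
  exact h.antisymm u r hu1 hu2 hr1 hr2 hu.1 hu.2 (by omega) (by omega)

/-- Each summand is the sum of the variables over the interval of a root. These intervals cover
everything by `exists_root`, and they are disjoint because two roots with a common point would be
comparable. -/
theorem IsLaminar.sum_roots {n : ℕ} {lo hi : ℕ → ℕ} (h : IsLaminar n lo hi) :
    ∑ r ∈ forestRoots n lo hi, (frob ^ (lo r - 1)) (bracket (hi r + 1 - lo r)) = bracket n := by
  -- The label `v` corresponds to the variable `xvar (v - 1)`, hence the intervals start at `lo r -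
  -- 1`.
  have e : range n = (forestRoots n lo hi).biUnion fun r =>
      Ico (lo r - 1) (lo r - 1 + (hi r + 1 - lo r)) := by
    ext i
    simp only [mem_range, mem_biUnion, mem_Ico]
    constructor
    · intro hi
      obtain ⟨r, hr, h3, h4⟩ := h.exists_root (i + 1) (by omega) (by omega)
      exact ⟨r, hr, by omega, by omega⟩
    · rintro ⟨r, hr, h3, h4⟩
      obtain ⟨hr1, hr2, -⟩ := mem_forestRoots.1 hr
      have := h.hi_le r hr1 hr2
      have := h.one_le r hr1 hr2
      omega
  rw [bracket, e, sum_biUnion]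
  · exact sum_congr rfl fun r _ => frob_pow_bracket _ _
  · intro r hr r' hr' hne
    refine disjoint_left.2 fun i hi hi' => hne ?_
    obtain ⟨hr1, hr2, hr3⟩ := mem_forestRoots.1 hr
    obtain ⟨hr1', hr2', hr3'⟩ := mem_forestRoots.1 hr'
    rw [mem_Ico] at hi hi'
    have := h.one_le r hr1 hr2
    have := h.one_le r' hr1' hr2'
    by_contra hne
    rcases h.comparable r r' (i + 1) hr1 hr2 hr1' hr2' (by omega) (by omega) (by omega) (by omega)
      with hc | hc
    · exact hr3' r hr1 hr2 hne hc
    · exact hr3 r' hr1' hr2' (Ne.symm hne) hc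

/-- The product of the analogues `F^{a-1}[h]` of the hook lengths of a forest, where `h` is the
size and `a` the least label of a subtree. -/
noncomputable def hookProduct (n : ℕ) (lo hi : ℕ → ℕ) : RatFun :=
  ∏ v ∈ Icc 1 n, (frob ^ (lo v - 1)) (bracket (hi v + 1 - lo v))

theorem IsLaminar.hookProduct_ne_zero {n : ℕ} {lo hi : ℕ → ℕ} (h : IsLaminar n lo hi) :
    hookProduct n lo hi ≠ 0 := by
  refine prod_ne_zero_iff.2 fun v hv => (map_ne_zero _).2 (bracket_ne_zero ?_)
  obtain ⟨h1, h2⟩ := mem_Icc.1 hv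
  have := h.lo_le v h1 h2
  have := h.le_hi v h1 h2
  omega

theorem prod_Icc_one_add {M : Type*} [CommMonoid M] (f : ℕ → M) (k l : ℕ) :
    ∏ v ∈ Icc 1 (k + l), f v = (∏ v ∈ Icc 1 k, f v) * ∏ v ∈ Icc 1 l, f (v + k) := by
  induction l with
  | zero => simp
  | succ l ih =>
    rw [← Nat.add_assoc, prod_Icc_succ_top (by omega), ih, prod_Icc_succ_top (by omega), mul_assoc]
    congr 3
    omega

/-- Deleting `r` leaves every other interval intact; lowering the labels above `r` by `r` is
compensated by F^r. -/
theorem IsLaminar.hookProduct_eq {n r : ℕ} {lo hi : ℕ → ℕ} (h : IsLaminar n lo hi)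
    (hr : r ∈ forestRoots n lo hi) :
    hookProduct n lo hi = hookProduct (r - 1) lo hi *
      (frob ^ (lo r - 1)) (bracket (hi r + 1 - lo r)) *
      (frob ^ r) (hookProduct (n - r) (fun v => lo (v + r) - r) (fun v => hi (v + r) - r)) := by
  obtain ⟨hr1, hr2, -⟩ := mem_forestRoots.1 hr
  have e := prod_Icc_one_add
    (fun v => (frob ^ (lo v - 1)) (bracket (hi v + 1 - lo v))) r (n - r)
  rw [Nat.add_sub_cancel' hr2] at e
  rw [hookProduct, e]
  congr 1
  · obtain ⟨k, rfl⟩ : ∃ k, r = k + 1 := ⟨r - 1, by omega⟩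
    rw [prod_Icc_succ_top (by omega)]
    rfl
  · rw [hookProduct, map_prod]
    refine prod_congr rfl fun v hv => ?_
    obtain ⟨h1, h2⟩ := mem_Icc.1 hv
    have := h.lt_lo hr (v + r) (by omega) (by omega)
    have := h.le_hi (v + r) (by omega) (by omega)
    have e1 : lo (v + r) - 1 = r + (lo (v + r) - r - 1) := by omega
    have e2 : hi (v + r) + 1 - lo (v + r) = hi (v + r) - r + 1 - (lo (v + r) - r) := by omega
    rw [← frob_pow_add_apply, ← e1, ← e2]

/-- The multivariate hook formula for recursively labelled forests. -/
theorem IsLaminar.sum_wtWord {n : ℕ} {lo hi : ℕ → ℕ} (h : IsLaminar n lo hi) :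
    ∑ w ∈ forestWords n lo hi, wtWord w = bracketFactorial n / hookProduct n lo hi := by
  induction n using Nat.strong_induction_on generalizing lo hi with
  | _ n ih =>
    rcases Nat.eq_zero_or_pos n with rfl | hn
    · have : forestWords 0 lo hi = {[]} := by
        ext l
        rw [mem_singleton]
        constructor
        · exact fun hl => List.length_eq_zero_iff.1 (length_of_mem_forestWords hl)
        · rintro rfl
          exact mem_forestWords.2 ⟨List.nodup_nil, fun v => by simp; omega, List.Pairwise.nil⟩
      rw [this, sum_singleton, wtWord_nil]
      simp [hookProduct, bracketFactorial]
    rw [h.sum_forestWords hn.ne']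
    -- The contribution of `r` depends on `r` only through its own hook factor, which is missing
    -- from the hook products of the two smaller forests.
    have step : ∀ r ∈ forestRoots n lo hi,
        ∑ a ∈ forestWords (r - 1) lo hi,
        ∑ b ∈ forestWords (n - r) (fun v => lo (v + r) - r) (fun v => hi (v + r) - r),
        ∑ t ∈ wordShuffles a (b.map (fun v => v + r)), wtWord (r :: t) =
          frob (bracketFactorial (n - 1)) / hookProduct n lo hi *
            (frob ^ (lo r - 1)) (bracket (hi r + 1 - lo r)) := by
      intro r hr
      obtain ⟨hr1, hr2, -⟩ := mem_forestRoots.1 hr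
      have hA := h.restrict_below hr
      have hB := h.restrict_above hr
      -- With `a` and `b` fixed, only the set weight varies over the shuffles, and the binomial
      -- theorem sums it.
      have inner : ∀ a ∈ forestWords (r - 1) lo hi,
          ∀ b ∈ forestWords (n - r) (fun v => lo (v + r) - r) (fun v => hi (v + r) - r),
          ∑ t ∈ wordShuffles a (b.map (fun v => v + r)), wtWord (r :: t) =
            frob (bracketFactorial (n - 1)) / (frob ^ r) (bracketFactorial (n - r)) /
              bracketFactorial (r - 1) * (wtWord a * (frob ^ r) (wtWord b)) := by
        intro a ha b hb
        have e : ∀ t ∈ wordShuffles a (b.map (fun v => v + r)), wtWord (r :: t) =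
            frob (positionWeight r t) / bracketFactorial (r - 1) *
              (wtWord a * (frob ^ r) (wtWord b)) := by
          intro t ht
          obtain ⟨hta, htb⟩ := (mem_wordShuffles_lt ha).1 ht
          have hrt := notMem_of_filter_eq hb htb
          have e1 : lettersBelow r t = a := hta
          have e2 : lettersAbove r t = b :=
            lettersAbove_eq_of_filter_eq ((filter_not_lt_eq hrt).symm.trans htb)
          rw [wtWord_cons, e1, e2, length_of_mem_forestWords ha, mul_assoc]
        have hsum := sum_positionWeight_wordShuffles r a (b.map (fun v => v + r))
          (fun x hx => by
            have := ((mem_forestWords.1 ha).2.1 x).1 hx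
            omega)
          (fun x hx => by
            obtain ⟨v, -, rfl⟩ := List.mem_map.1 hx
            omega)
        rw [List.length_map, length_of_mem_forestWords ha, length_of_mem_forestWords hb] at hsum
        rw [sum_congr rfl e, ← sum_mul, ← sum_div, ← map_sum, hsum, map_div₀,
          ← frob_pow_succ_apply']
        -- The lengths r - 1 and n - r add up to n - 1, and the outer Frobenius turns F^{r-1} into
        -- F^r.
        congr 5 <;> omega
      rw [sum_congr rfl fun a ha => sum_congr rfl fun b hb => inner a ha b hb]
      simp only [← mul_sum]
      rw [← sum_mul, ← map_sum, ih (r - 1) (by omega) hA, ih (n - r) (by omega) hB,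
        map_div₀, h.hookProduct_eq hr]
      have n1 := hA.hookProduct_ne_zero
      have n2 := (map_ne_zero (frob ^ r)).2 hB.hookProduct_ne_zero
      have n3 := (map_ne_zero (frob ^ r)).2 (bracketFactorial_ne_zero (n - r))
      have n4 := bracketFactorial_ne_zero (r - 1)
      have n5 : (frob ^ (lo r - 1)) (bracket (hi r + 1 - lo r)) ≠ 0 := by
        refine (map_ne_zero _).2 (bracket_ne_zero ?_)
        have := h.lo_le r hr1 hr2
        have := h.le_hi r hr1 hr2
        omega
      field_simp
    -- The hook factors of the roots add up to [n], which completes F([n-1]!) to [n]!.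
    rw [sum_congr rfl step, ← mul_sum, h.sum_roots]
    obtain ⟨m, rfl⟩ : ∃ m, n = m + 1 := ⟨n - 1, by omega⟩
    rw [bracketFactorial, Nat.add_sub_cancel]
    ring

/-! ### From partial orders to intervals and back -/

/-- The intervals `[lo v, hi v]` describe the order `P` on `{1, …, n}`. -/
def RepresentsOrder {n : ℕ} (P : PartialOrder (Fin n)) (lo hi : ℕ → ℕ) : Prop :=
  ∀ i j : Fin n, P.le i j ↔ lo (i + 1) ≤ (j : ℕ) + 1 ∧ (j : ℕ) + 1 ≤ hi (i + 1)

/-- By finiteness, anything strictly below `k` lies below an element covered by `k`. That element is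
unique, so two strict lower bounds of `k` are both below it and induction applies. -/
theorem le_or_le_of_unique_covBy {α : Type*} [PartialOrder α] [Finite α]
    (h : ∀ i j j' : α, j ⋖ i → j' ⋖ i → j = j') (k : α) :
    ∀ i j : α, i ≤ k → j ≤ k → i ≤ j ∨ j ≤ i := by
  induction k using (wellFounded_lt (α := α)).induction with
  | _ k ih =>
    intro i j hi hj
    rcases eq_or_lt_of_le hi with rfl | hi'
    · exact Or.inr hj
    rcases eq_or_lt_of_le hj with rfl | hj'
    · exact Or.inl hi
    obtain ⟨c, hc, hck⟩ := exists_le_covBy_of_lt hi'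
    obtain ⟨c', hc', hck'⟩ := exists_le_covBy_of_lt hj'
    obtain rfl := h k c c' hck hck'
    exact ih c hck.1 i j hc hc'

theorem IsForest.le_or_le {n : ℕ} {P : PartialOrder (Fin n)} (hP : IsForest P) (k i j : Fin n)
    (hi : P.le i k) (hj : P.le j k) : P.le i j ∨ P.le j i :=
  @le_or_le_of_unique_covBy (Fin n) P inferInstance hP k i j hi hj

theorem eq_of_covBy_of_le_or_le {α : Type*} [PartialOrder α] {i j j' : α} (hj : j ⋖ i)
    (hj' : j' ⋖ i) (hc : j ≤ j' ∨ j' ≤ j) : j = j' := by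
  rcases hc with hc | hc
  · exact (eq_or_lt_of_le hc).resolve_right fun hlt => hj.2 hlt hj'.1
  · exact ((eq_or_lt_of_le hc).resolve_right fun hlt => hj'.2 hlt hj.1).symm

/-- The last three laminarity axioms are transitivity, antisymmetry and the fact that lower sets of
single elements are chains, read on principal filters. -/
theorem exists_isLaminar {n : ℕ} {P : PartialOrder (Fin n)} (hF : IsForest P)
    (hR : IsRecursivelyLabelled P) :
    ∃ lo hi, IsLaminar n lo hi ∧ RepresentsOrder P lo hi := by
  choose a b hab using hR
  have hrefl : ∀ i : Fin n, a i ≤ i ∧ (i : ℕ) ≤ b i := fun i => (hab i i).1 (P.le_refl i)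
  let lo : ℕ → ℕ := fun v => if h : v - 1 < n then a ⟨v - 1, h⟩ + 1 else 0
  -- The given right endpoint may exceed the largest label, so it is cut off at `n`. The default 0
  -- is never used for labels between 1 and `n`.
  let hi : ℕ → ℕ := fun v => if h : v - 1 < n then min (b ⟨v - 1, h⟩ + 1) n else 0
  have hlo : ∀ i : Fin n, lo (i + 1) = a i + 1 := fun i => by simp [lo]
  have hhi : ∀ i : Fin n, hi (i + 1) = min (b i + 1) n := fun i => by simp [hi]
  have hrep : RepresentsOrder P lo hi := by
    intro i j
    rw [hab, hlo, hhi]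
    omega
  have hfin : ∀ v, 1 ≤ v → v ≤ n → ∃ i : Fin n, v = i + 1 := fun v h1 h2 =>
    ⟨⟨v - 1, by omega⟩, by simp only; omega⟩
  refine ⟨lo, hi, ⟨?_, ?_, ?_, ?_, ?_, ?_, ?_⟩, hrep⟩
  · intro v h1 h2
    obtain ⟨i, rfl⟩ := hfin v h1 h2
    rw [hlo]; omega
  · intro v h1 h2
    obtain ⟨i, rfl⟩ := hfin v h1 h2
    exact ((hrep i i).1 (P.le_refl i)).1
  · intro v h1 h2
    obtain ⟨i, rfl⟩ := hfin v h1 h2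
    exact ((hrep i i).1 (P.le_refl i)).2
  · intro v h1 h2
    obtain ⟨i, rfl⟩ := hfin v h1 h2
    rw [hhi]; omega
  · intro v w h1 h2 h3 h4 h5 h6
    obtain ⟨i, rfl⟩ := hfin v h1 h2
    obtain ⟨j, rfl⟩ := hfin w h3 h4
    have hij : P.le i j := (hrep i j).2 ⟨h5, h6⟩
    have haj := hrefl j
    have key : ∀ k : Fin n, a j ≤ k → (k : ℕ) ≤ b j → a i ≤ k ∧ (k : ℕ) ≤ b i :=
      fun k h h' => (hab i k).1 (P.le_trans i j k hij ((hab j k).2 ⟨h, h'⟩))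
    -- Transitivity, tested at the two ends of the interval of `j`, yields nestedness.
    have k1 := key ⟨a j, by omega⟩ le_rfl (by simp only; omega)
    have k2 := key ⟨min (b j) (n - 1), by omega⟩ (by simp only; omega) (by simp only; omega)
    simp only at k1 k2
    rw [hlo, hlo, hhi, hhi]
    omega
  · intro v w h1 h2 h3 h4 h5 h6 h7 h8
    obtain ⟨i, rfl⟩ := hfin v h1 h2
    obtain ⟨j, rfl⟩ := hfin w h3 h4
    rw [P.le_antisymm i j ((hrep i j).2 ⟨h5, h6⟩) ((hrep j i).2 ⟨h7, h8⟩)]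
  · intro v w k h1 h2 h3 h4 h5 h6 h7 h8
    obtain ⟨i, rfl⟩ := hfin v h1 h2
    obtain ⟨j, rfl⟩ := hfin w h3 h4
    have hk : 1 ≤ k ∧ k ≤ n := by
      rw [hlo] at h5
      rw [hhi] at h6
      omega
    obtain ⟨k, rfl⟩ := hfin k hk.1 hk.2
    rw [← hrep, ← hrep]
    exact hF.le_or_le k i j ((hrep i k).2 ⟨h5, h6⟩) ((hrep j k).2 ⟨h7, h8⟩)

namespace IsLaminar

/-- The recursively labelled forest given by its principal filters. -/
abbrev toPartialOrder {n : ℕ} {lo hi : ℕ → ℕ} (h : IsLaminar n lo hi) : PartialOrder (Fin n) where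
  le i j := lo (i + 1) ≤ (j : ℕ) + 1 ∧ (j : ℕ) + 1 ≤ hi (i + 1)
  lt i j := (lo (i + 1) ≤ (j : ℕ) + 1 ∧ (j : ℕ) + 1 ≤ hi (i + 1)) ∧
    ¬ (lo (j + 1) ≤ (i : ℕ) + 1 ∧ (i : ℕ) + 1 ≤ hi (j + 1))
  lt_iff_le_not_ge _ _ := Iff.rfl
  le_refl i := ⟨h.lo_le _ (by omega) (by omega), h.le_hi _ (by omega) (by omega)⟩
  le_trans i j k hij hjk := by
    have := h.nested (i + 1) (j + 1) (by omega) (by omega) (by omega) (by omega) hij.1 hij.2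
    omega
  le_antisymm i j hij hji := by
    have := h.antisymm (i + 1) (j + 1) (by omega) (by omega) (by omega) (by omega) hij.1 hij.2
      hji.1 hji.2
    exact Fin.ext (by omega)

variable {n : ℕ} {lo hi : ℕ → ℕ}

theorem representsOrder (h : IsLaminar n lo hi) : RepresentsOrder h.toPartialOrder lo hi :=
  fun _ _ => Iff.rfl

theorem isForest (h : IsLaminar n lo hi) : IsForest h.toPartialOrder := by
  intro i j j' hj hj'
  have hji : h.toPartialOrder.le j i := @LT.lt.le (Fin n) h.toPartialOrder.toPreorder _ _ hj.1
  have hji' : h.toPartialOrder.le j' i := @LT.lt.le (Fin n) h.toPartialOrder.toPreorder _ _ hj'.1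
  exact @eq_of_covBy_of_le_or_le (Fin n) h.toPartialOrder i j j' hj hj'
    (h.comparable (j + 1) (j' + 1) (i + 1) (by omega) (by omega) (by omega) (by omega)
      hji.1 hji.2 hji'.1 hji'.2)

theorem isRecursivelyLabelled (h : IsLaminar n lo hi) :
    IsRecursivelyLabelled h.toPartialOrder := by
  intro i
  refine ⟨lo (i + 1) - 1, hi (i + 1) - 1, fun j => (h.representsOrder i j).trans ?_⟩
  have := h.one_le (i + 1) (by omega) (by omega)
  have := h.le_hi (i + 1) (by omega) (by omega)
  omega

end IsLaminar

/-! ### Disjoint unions of forests -/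

/-- Intervals on `{1, …, n + m}` from intervals on `{1, …, n}` and on `{1, …, m}`. -/
def concatIntervals (n : ℕ) (f g : ℕ → ℕ) (v : ℕ) : ℕ := if v ≤ n then f v else g (v - n) + n

theorem concatIntervals_of_le {n v : ℕ} (f g : ℕ → ℕ) (h : v ≤ n) :
    concatIntervals n f g v = f v := if_pos h

theorem concatIntervals_add {n v : ℕ} (f g : ℕ → ℕ) (h : 1 ≤ v) :
    concatIntervals n f g (v + n) = g v + n := by
  rw [concatIntervals, if_neg (by omega), Nat.add_sub_cancel]

/-- Every interval stays inside its own block, so each axiom either concerns a single block or has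
contradictory premises. -/
theorem IsLaminar.concat {n m : ℕ} {lo hi lo' hi' : ℕ → ℕ} (h : IsLaminar n lo hi)
    (h' : IsLaminar m lo' hi') :
    IsLaminar (n + m) (concatIntervals n lo lo') (concatIntervals n hi hi') := by
  have cases : ∀ v, 1 ≤ v → v ≤ n + m →
      (1 ≤ v ∧ v ≤ n ∧ concatIntervals n lo lo' v = lo v ∧ concatIntervals n hi hi' v = hi v ∧
        1 ≤ lo v ∧ lo v ≤ v ∧ v ≤ hi v ∧ hi v ≤ n) ∨
      ∃ u, v = u + n ∧ 1 ≤ u ∧ u ≤ m ∧ concatIntervals n lo lo' v = lo' u + n ∧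
        concatIntervals n hi hi' v = hi' u + n ∧
        1 ≤ lo' u ∧ lo' u ≤ u ∧ u ≤ hi' u ∧ hi' u ≤ m := by
    intro v h1 h2
    by_cases hv : v ≤ n
    · exact Or.inl ⟨h1, hv, concatIntervals_of_le _ _ hv, concatIntervals_of_le _ _ hv,
        h.one_le v h1 hv, h.lo_le v h1 hv, h.le_hi v h1 hv, h.hi_le v h1 hv⟩
    · obtain ⟨u, rfl⟩ : ∃ u, v = u + n := ⟨v - n, by omega⟩
      have u1 : 1 ≤ u := by omega
      have u2 : u ≤ m := by omega
      exact Or.inr ⟨u, rfl, u1, u2, concatIntervals_add _ _ u1, concatIntervals_add _ _ u1,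
        h'.one_le u u1 u2, h'.lo_le u u1 u2, h'.le_hi u u1 u2, h'.hi_le u u1 u2⟩
  refine ⟨fun v h1 h2 => ?_, fun v h1 h2 => ?_, fun v h1 h2 => ?_, fun v h1 h2 => ?_,
    fun i j h1 h2 h3 h4 h5 h6 => ?_, fun i j h1 h2 h3 h4 h5 h6 h7 h8 => ?_,
    fun i j k h1 h2 h3 h4 h5 h6 h7 h8 => ?_⟩
  iterate 4
    rcases cases v h1 h2 with c | ⟨u, c⟩ <;> omega
  · rcases cases i h1 h2 with c | ⟨u, c⟩ <;> rcases cases j h3 h4 with d | ⟨u', d⟩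
    · have := h.nested i j (by omega) (by omega) (by omega) (by omega) (by omega) (by omega)
      omega
    · omega
    · omega
    · have := h'.nested u u' (by omega) (by omega) (by omega) (by omega) (by omega) (by omega)
      omega
  · rcases cases i h1 h2 with c | ⟨u, c⟩ <;> rcases cases j h3 h4 with d | ⟨u', d⟩
    · have := h.antisymm i j (by omega) (by omega) (by omega) (by omega) (by omega) (by omega)
        (by omega) (by omega)
      omega
    · omega
    · omega
    · have := h'.antisymm u u' (by omega) (by omega) (by omega) (by omega) (by omega) (by omega)
        (by omega) (by omega)
      omega
  · rcases cases i h1 h2 with c | ⟨u, c⟩ <;> rcases cases j h3 h4 with d | ⟨u', d⟩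
    · have := h.comparable i j k (by omega) (by omega) (by omega) (by omega) (by omega) (by omega)
        (by omega) (by omega)
      omega
    · omega
    · omega
    · have := h'.comparable u u' (k - n) (by omega) (by omega) (by omega) (by omega) (by omega)
        (by omega) (by omega) (by omega)
      omega

/-- Raising the labels by `n` keeps subtree sizes and applies F^n to each hook factor; this matches
the twist in `monomialU_mul`. -/
theorem hookProduct_concat {n m : ℕ} {lo hi lo' hi' : ℕ → ℕ} (h' : IsLaminar m lo' hi') :
    hookProduct (n + m) (concatIntervals n lo lo') (concatIntervals n hi hi') =
      hookProduct n lo hi * (frob ^ n) (hookProduct m lo' hi') := by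
  rw [hookProduct, prod_Icc_one_add, hookProduct, hookProduct, map_prod]
  congr 1
  · refine prod_congr rfl fun v hv => ?_
    rw [concatIntervals_of_le _ _ (mem_Icc.1 hv).2, concatIntervals_of_le _ _ (mem_Icc.1 hv).2]
  · refine prod_congr rfl fun v hv => ?_
    obtain ⟨h1, h2⟩ := mem_Icc.1 hv
    have := h'.one_le v h1 h2
    have e1 : lo' v + n - 1 = n + (lo' v - 1) := by omega
    have e2 : hi' v + n + 1 - (lo' v + n) = hi' v + 1 - lo' v := by omega
    rw [concatIntervals_add _ _ h1, concatIntervals_add _ _ h1, e1, e2, frob_pow_add_apply]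

/-! ### Linear extensions as permutations, and the values of `phiInv` -/

/-- The linear extensions of `P`, as elements of the union of all symmetric groups. -/
noncomputable def linearExtensionPerms {n : ℕ} (P : PartialOrder (Fin n)) : Finset AllPerm :=
  (linearExtensions P).map (Function.Embedding.sigmaMk n)

theorem FPoset_eq_sum {n : ℕ} (P : PartialOrder (Fin n)) :
    FQSym.FPoset P = ∑ w ∈ linearExtensionPerms P, FQSym.F w := by
  rw [linearExtensionPerms, sum_map]
  rfl

/-- The two conditions are contrapositives: one orders the positions of comparable labels, the other
forbids a later letter from being below an earlier one in `P`. -/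
theorem RepresentsOrder.mem_linearExtensions {n : ℕ} {P : PartialOrder (Fin n)} {lo hi : ℕ → ℕ}
    (h : RepresentsOrder P lo hi) (w : Equiv.Perm (Fin n)) :
    w ∈ linearExtensions P ↔ oneLine ⟨n, w⟩ ∈ forestWords n lo hi := by
  rw [mem_forestWords, and_iff_right (nodup_oneLine _), and_iff_right (mem_oneLine ⟨n, w⟩), oneLine,
    List.pairwise_ofFn]
  simp only [linearExtensions, mem_filter, mem_univ, true_and, ← h (w _) (w _)]
  constructor
  · intro H i j hij hle
    have hne : w j ≠ w i := fun e =>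
      Nat.ne_of_gt hij (congrArg Fin.val (w.injective e))
    have := H (w j) (w i) (@lt_of_le_of_ne (Fin n) P _ _ hle hne)
    rw [w.symm_apply_apply, w.symm_apply_apply] at this
    exact absurd hij (Nat.lt_asymm this)
  · intro H i j hij
    by_contra hc
    have hne : w.symm i ≠ w.symm j := fun e =>
      @ne_of_lt (Fin n) P.toPreorder _ _ hij (w.symm.injective e)
    have hlt : (w.symm j : ℕ) < (w.symm i : ℕ) := by
      have : (w.symm i : ℕ) ≠ (w.symm j : ℕ) := fun e => hne (Fin.ext e)
      omega
    have := H (i := w.symm j) (j := w.symm i) hlt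
    rw [w.apply_symm_apply, w.apply_symm_apply] at this
    exact this (@le_of_lt (Fin n) P.toPreorder _ _ hij)

theorem RepresentsOrder.mem_linearExtensionPerms {n : ℕ} {P : PartialOrder (Fin n)}
    {lo hi : ℕ → ℕ} (h : RepresentsOrder P lo hi) (w : AllPerm) :
    w ∈ linearExtensionPerms P ↔ oneLine w ∈ forestWords n lo hi := by
  rw [linearExtensionPerms, mem_map]
  constructor
  · rintro ⟨v, hv, rfl⟩
    exact (h.mem_linearExtensions v).1 hv
  · intro hw
    obtain ⟨k, v⟩ := w
    obtain rfl : k = n := (length_oneLine _).symm.trans (length_of_mem_forestWords hw)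
    exact ⟨v, (h.mem_linearExtensions v).2 hw, rfl⟩

theorem RepresentsOrder.sum_wt {n : ℕ} {P : PartialOrder (Fin n)} {lo hi : ℕ → ℕ}
    (h : RepresentsOrder P lo hi) :
    ∑ w ∈ linearExtensionPerms P, wt w = ∑ l ∈ forestWords n lo hi, wtWord l := by
  refine sum_bij (fun w _ => oneLine w) (fun w hw => (h.mem_linearExtensionPerms w).1 hw)
    (fun _ _ _ _ e => oneLine_injective e) (fun l hl => ?_) (fun _ _ => rfl)
  obtain ⟨h1, h2, -⟩ := mem_forestWords.1 hl
  obtain ⟨w, rfl⟩ := exists_oneLine l n h1 h2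
  exact ⟨⟨n, w⟩, (h.mem_linearExtensionPerms _).2 hl, rfl⟩

theorem smul_monomialU (f g : RatFun) (n : ℕ) : f • monomialU g n = monomialU (f * g) n := by
  rw [monomialU, monomialU, SkewMonoidAlgebra.smul_single, smul_eq_mul]

theorem phiInv_F (w : AllPerm) :
    phiInv (FQSym.F w) = monomialU (wt w * (1 / bracketFactorial w.1)) w.1 := by
  rw [← smul_monomialU]
  exact FQSym.basis.constr_basis ℚ _ w

theorem monomialU_sum {ι : Type*} (s : Finset ι) (f : ι → RatFun) (n : ℕ) :
    ∑ i ∈ s, monomialU (f i) n = monomialU (∑ i ∈ s, f i) n :=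
  (map_sum (SkewMonoidAlgebra.singleAddHom (Multiplicative.ofAdd n)) f s).symm

theorem phiInv_sum_F {n : ℕ} {s : Finset AllPerm} (hs : ∀ w ∈ s, w.1 = n) :
    phiInv (∑ w ∈ s, FQSym.F w) = monomialU ((∑ w ∈ s, wt w) * (1 / bracketFactorial n)) n := by
  rw [map_sum, sum_mul, ← monomialU_sum]
  exact sum_congr rfl fun w hw => by rw [phiInv_F, hs w hw]

/-- The factorial in the hook formula cancels the denominator of the divided power. -/
theorem IsLaminar.phiInv_FPoset {n : ℕ} {P : PartialOrder (Fin n)} {lo hi : ℕ → ℕ}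
    (hl : IsLaminar n lo hi) (h : RepresentsOrder P lo hi) :
    phiInv (FQSym.FPoset P) = monomialU (1 / hookProduct n lo hi) n := by
  rw [FPoset_eq_sum, phiInv_sum_F (n := n), h.sum_wt, hl.sum_wtWord]
  · congr 1
    have := bracketFactorial_ne_zero n
    field_simp
  · intro w hw
    rw [h.mem_linearExtensionPerms] at hw
    exact (length_oneLine w).symm.trans (length_of_mem_forestWords hw)

/-- No order relation joins the two blocks, so a word is admissible exactly when its two subwords
are, however they interleave. -/
theorem IsLaminar.mem_forestWords_concat {n m : ℕ} {lo hi lo' hi' : ℕ → ℕ}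
    (h : IsLaminar n lo hi) (h' : IsLaminar m lo' hi') (w : AllPerm) :
    oneLine w ∈ forestWords (n + m) (concatIntervals n lo lo') (concatIntervals n hi hi') ↔
      ∃ a b, oneLine a ∈ forestWords n lo hi ∧ oneLine b ∈ forestWords m lo' hi' ∧
        IsShuffle a b w := by
  have hfilter : (oneLine w).filter (fun v => ¬ v ≤ n) = (oneLine w).filter (fun v => n < v) :=
    List.filter_congr fun v _ => decide_eq_decide.2 not_le
  have hsplit : w.1 = n + m → ((oneLine w).Pairwise (fun x y =>
      ¬ (concatIntervals n lo lo' y ≤ x ∧ x ≤ concatIntervals n hi hi' y)) ↔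
      ((oneLine w).filter (fun v => v ≤ n)).Pairwise (fun x y => ¬ (lo y ≤ x ∧ x ≤ hi y)) ∧
      ((oneLine w).filter (fun v => n < v)).Pairwise (fun x y =>
        ¬ (concatIntervals n lo lo' y ≤ x ∧ x ≤ concatIntervals n hi hi' y))) := by
    intro hw
    rw [List.pairwise_iff_pairwise_filter (· ≤ n), hfilter]
    · refine and_congr_left fun _ => ?_
      refine List.Pairwise.iff_of_mem fun {x y} _ hy => ?_
      have hy' : y ≤ n := by simpa using (List.mem_filter.1 hy).2
      rw [concatIntervals_of_le _ _ hy', concatIntervals_of_le _ _ hy']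
    · intro x hx y hy hxy
      rw [mem_oneLine, hw] at hx hy
      by_cases hy' : y ≤ n
      · rw [concatIntervals_of_le _ _ hy', concatIntervals_of_le _ _ hy']
        have := h.hi_le y hy.1 hy'
        omega
      · obtain ⟨u, rfl⟩ : ∃ u, y = u + n := ⟨y - n, by omega⟩
        rw [concatIntervals_add _ _ (by omega), concatIntervals_add _ _ (by omega)]
        have := h'.one_le u (by omega) (by omega)
        omega
  have hshift : ∀ b : AllPerm, ((oneLine b).map (fun v => v + n)).Pairwise (fun x y =>
        ¬ (concatIntervals n lo lo' y ≤ x ∧ x ≤ concatIntervals n hi hi' y)) ↔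
      (oneLine b).Pairwise (fun x y => ¬ (lo' y ≤ x ∧ x ≤ hi' y)) := by
    intro b
    rw [List.pairwise_map]
    refine List.Pairwise.iff_of_mem fun {x y} _ hy => ?_
    rw [mem_oneLine] at hy
    rw [concatIntervals_add _ _ hy.1, concatIntervals_add _ _ hy.1]
    omega
  constructor
  · intro hw
    have hn : w.1 = n + m := (length_oneLine w).symm.trans (length_of_mem_forestWords hw)
    obtain ⟨-, -, h3⟩ := mem_forestWords.1 hw
    rw [hsplit hn] at h3
    obtain ⟨a, ha⟩ := exists_restrict_le w n (by omega)
    obtain ⟨b, hb⟩ := exists_restrict_gt w n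
    refine ⟨⟨n, a⟩, ⟨w.1 - n, b⟩, mem_forestWords.2 ⟨nodup_oneLine _, mem_oneLine _, ?_⟩,
      mem_forestWords.2 ⟨nodup_oneLine _, fun v => ?_, ?_⟩, ha.symm, hb.symm⟩
    · rw [ha]; exact h3.1
    · rw [mem_oneLine]
      simp only
      omega
    · rw [← hshift, hb]; exact h3.2
  · rintro ⟨a, b, ha, hb, hs⟩
    have han : a.1 = n := (length_oneLine a).symm.trans (length_of_mem_forestWords ha)
    have hbm : b.1 = m := (length_oneLine b).symm.trans (length_of_mem_forestWords hb)
    have hn : w.1 = n + m := by rw [hs.size, han, hbm]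
    obtain ⟨hs1, hs2⟩ := hs
    rw [han] at hs1 hs2
    refine mem_forestWords.2 ⟨nodup_oneLine _, fun v => by rw [mem_oneLine, hn], ?_⟩
    rw [hsplit hn, hs1, hs2, hshift]
    exact ⟨(mem_forestWords.1 ha).2.2, (mem_forestWords.1 hb).2.2⟩

/-- The product of the elements attached to two forests is attached to their disjoint union. -/
theorem IsLaminar.FPoset_mul_FPoset {n m : ℕ} {lo hi lo' hi' : ℕ → ℕ} {P : PartialOrder (Fin n)}
    {Q : PartialOrder (Fin m)} (hl : IsLaminar n lo hi) (hl' : IsLaminar m lo' hi')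
    (h : RepresentsOrder P lo hi) (h' : RepresentsOrder Q lo' hi') :
    FQSym.FPoset P * FQSym.FPoset Q = FQSym.FPoset (hl.concat hl').toPartialOrder := by
  classical
  have key : linearExtensionPerms (hl.concat hl').toPartialOrder =
      (linearExtensionPerms P).biUnion fun a =>
        (linearExtensionPerms Q).biUnion fun b => shuffles a b := by
    ext w
    simp only [mem_biUnion, mem_shuffles, h.mem_linearExtensionPerms, h'.mem_linearExtensionPerms,
      (hl.concat hl').representsOrder.mem_linearExtensionPerms, hl.mem_forestWords_concat hl']
    constructor
    · rintro ⟨a, b, ha, hb, hs⟩; exact ⟨a, ha, b, hb, hs⟩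
    · rintro ⟨a, ha, b, hb, hs⟩; exact ⟨a, b, ha, hb, hs⟩
  have hsize : ∀ a ∈ linearExtensionPerms P, a.1 = n := fun a ha =>
    (length_oneLine a).symm.trans
      (length_of_mem_forestWords ((h.mem_linearExtensionPerms a).1 ha))
  rw [FPoset_eq_sum, FPoset_eq_sum, FPoset_eq_sum, key, sum_mul_sum, sum_biUnion]
  · refine sum_congr rfl fun a _ => ?_
    rw [sum_biUnion]
    · exact sum_congr rfl fun b _ => FQSym.F_mul_F a b
    · intro b _ b' _ hne
      exact disjoint_left.2 fun w hw hw' =>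
        hne (shuffle_right_unique (mem_shuffles.1 hw) (mem_shuffles.1 hw'))
  · intro a ha a' ha' hne
    refine disjoint_left.2 fun w hw hw' => hne ?_
    obtain ⟨b, -, hb⟩ := mem_biUnion.1 hw
    obtain ⟨b', -, hb'⟩ := mem_biUnion.1 hw'
    -- All linear extensions of `P` have the same size `n`, so the left factor of a shuffle is
    -- recovered as its letters `≤ n`.
    apply oneLine_injective
    rw [← (mem_shuffles.1 hb).1, ← (mem_shuffles.1 hb').1, hsize a ha, hsize a' ha']

/-! ### The subalgebra `PBT` and the homomorphism -/

theorem FPoset_mem_PBT {n : ℕ} {P : PartialOrder (Fin n)} (hF : IsForest P)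
    (hR : IsRecursivelyLabelled P) : FQSym.FPoset P ∈ PBT :=
  Submodule.subset_span ⟨n, P, hF, hR, rfl⟩

theorem F_empty_mem_PBT : FQSym.F ⟨0, 1⟩ ∈ PBT := by
  have hl : IsLaminar 0 id id := by
    constructor <;> intros <;> omega
  have : FQSym.FPoset hl.toPartialOrder = FQSym.F ⟨0, 1⟩ := by
    rw [FPoset_eq_sum]
    have : linearExtensionPerms hl.toPartialOrder = {⟨0, 1⟩} := by
      ext w
      rw [hl.representsOrder.mem_linearExtensionPerms, mem_singleton]
      constructor
      · intro hw
        apply oneLine_injective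
        rw [List.length_eq_zero_iff.1 (length_of_mem_forestWords hw)]
        simp [oneLine]
      · rintro rfl
        simp [mem_forestWords, oneLine]
        omega
    rw [this, sum_singleton]
  exact this ▸ FPoset_mem_PBT hl.isForest hl.isRecursivelyLabelled

/-- Both claims reduce by bilinearity to two forests, where the product is the generator of their
disjoint union and hook products multiply with the Frobenius twist. -/
theorem mul_mem_PBT_and_phiInv_mul {x y : FQSym} (hx : x ∈ PBT) (hy : y ∈ PBT) :
    x * y ∈ PBT ∧ phiInv (x * y) = phiInv x * phiInv y := by
  induction hx, hy using Submodule.span_induction₂ with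
  | mem_mem x y hx hy =>
    obtain ⟨n, P, hF, hR, rfl⟩ := hx
    obtain ⟨m, Q, hF', hR', rfl⟩ := hy
    obtain ⟨lo, hi, hl, h⟩ := exists_isLaminar hF hR
    obtain ⟨lo', hi', hl', h'⟩ := exists_isLaminar hF' hR'
    have hc := hl.concat hl'
    rw [hl.FPoset_mul_FPoset hl' h h']
    refine ⟨FPoset_mem_PBT hc.isForest hc.isRecursivelyLabelled, ?_⟩
    rw [hc.phiInv_FPoset hc.representsOrder, hl.phiInv_FPoset h, hl'.phiInv_FPoset h',
      monomialU_mul, hookProduct_concat hl', map_div₀, map_one, div_mul_div_comm, one_mul]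
  | zero_left y _ => simp
  | zero_right x _ => simp
  | add_left x y z _ _ _ h1 h2 =>
    rw [add_mul, map_add, map_add, add_mul, h1.2, h2.2]
    exact ⟨add_mem h1.1 h2.1, rfl⟩
  | add_right x y z _ _ _ h1 h2 =>
    rw [mul_add, map_add, map_add, mul_add, h1.2, h2.2]
    exact ⟨add_mem h1.1 h2.1, rfl⟩
  | smul_left r x y _ _ h =>
    rw [smul_mul_assoc, map_smul, map_smul, smul_mul_assoc, h.2]
    exact ⟨Submodule.smul_mem _ _ h.1, rfl⟩
  | smul_right r x y _ _ h =>
    rw [mul_smul_comm, map_smul, map_smul, mul_smul_comm, h.2]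
    exact ⟨Submodule.smul_mem _ _ h.1, rfl⟩

theorem phiInv_one : phiInv 1 = 1 := by
  rw [FQSym.one_def, phiInv_F]
  simp [wt, oneLine, wtWord_nil, bracketFactorial]
  rfl

/-- The subalgebra `PBT` of `FQSym`. -/
noncomputable def PBTSubalgebra : Subalgebra ℚ FQSym :=
  PBT.toSubalgebra F_empty_mem_PBT fun _ _ hx hy => (mul_mem_PBT_and_phiInv_mul hx hy).1

/-- The restriction of `phiInv` to `PBT`, as a homomorphism of algebras. -/
noncomputable def phiInvPBT : PBTSubalgebra →ₐ[ℚ] SkewAlg :=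
  AlgHom.ofLinearMap (phiInv ∘ₗ PBTSubalgebra.val.toLinearMap) phiInv_one
    fun x y => (mul_mem_PBT_and_phiInv_mul x.2 y.2).2

/-! ### The counterexample -/

theorem oneLine_perm1 : oneLine perm1 = [1] := by simp [oneLine, perm1]

theorem oneLine_perm213 : oneLine perm213 = [2, 1, 3] := by
  simp [oneLine, perm213, List.ofFn_succ]
  decide

/-- Replaces a filter over a whole symmetric group by a recursion that can be evaluated. -/
theorem mem_shuffles_iff_mem_wordShuffles {a b w : AllPerm} :
    w ∈ shuffles a b ↔ oneLine w ∈ wordShuffles (oneLine a) ((oneLine b).map (fun v => v + a.1)) := by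
  rw [mem_shuffles, mem_wordShuffles (· ≤ a.1)]
  · have : (oneLine w).filter (fun v => ¬ v ≤ a.1) = (oneLine w).filter (fun v => a.1 < v) :=
      List.filter_congr fun v _ => decide_eq_decide.2 not_le
    rw [this, IsShuffle]
  · exact fun x hx => ((mem_oneLine a x).1 hx).2
  · intro x hx
    obtain ⟨v, hv, rfl⟩ := List.mem_map.1 hx
    have := ((mem_oneLine b v).1 hv).1
    omega

theorem exists_oneLine_of_mem_wordShuffles {a b : AllPerm} {l : List ℕ}
    (hl : l ∈ wordShuffles (oneLine a) ((oneLine b).map (fun v => v + a.1))) :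
    ∃ w, oneLine w = l := by
  rw [mem_wordShuffles (· ≤ a.1)] at hl
  · obtain ⟨h1, h2⟩ := hl
    have hp := (List.filter_append_perm (fun v => decide (v ≤ a.1)) l).symm
    have h2' : l.filter (fun v => !decide (v ≤ a.1)) = (oneLine b).map (fun v => v + a.1) := by
      rw [← h2]
      exact List.filter_congr fun v _ => by rw [decide_not]
    rw [h1, h2'] at hp
    have hmem : ∀ v, v ∈ (oneLine b).map (fun v => v + a.1) ↔ a.1 < v ∧ v ≤ a.1 + b.1 := by
      intro v
      simp only [List.mem_map, mem_oneLine]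
      constructor
      · rintro ⟨u, hu, rfl⟩; omega
      · intro hv; exact ⟨v - a.1, by omega, by omega⟩
    obtain ⟨w, hw⟩ := exists_oneLine l (a.1 + b.1)
      (hp.nodup_iff.2 (List.nodup_append.2 ⟨nodup_oneLine a,
        (nodup_oneLine b).map (add_left_injective a.1), fun x hx y hy => by
          rw [mem_oneLine] at hx
          rw [hmem] at hy
          omega⟩))
      (fun v => by
        rw [hp.mem_iff, List.mem_append, mem_oneLine, hmem]
        omega)
    exact ⟨_, hw⟩
  · exact fun x hx => ((mem_oneLine a x).1 hx).2
  · intro x hx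
    obtain ⟨v, hv, rfl⟩ := List.mem_map.1 hx
    have := ((mem_oneLine b v).1 hv).1
    omega

theorem sum_wt_shuffles (a b : AllPerm) :
    ∑ w ∈ shuffles a b, wt w =
      ∑ l ∈ wordShuffles (oneLine a) ((oneLine b).map (fun v => v + a.1)), wtWord l := by
  refine sum_bij (fun w _ => oneLine w) (fun w hw => mem_shuffles_iff_mem_wordShuffles.1 hw)
    (fun _ _ _ _ e => oneLine_injective e) (fun l hl => ?_) (fun _ _ => rfl)
  obtain ⟨w, rfl⟩ := exists_oneLine_of_mem_wordShuffles hl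
  exact ⟨w, mem_shuffles_iff_mem_wordShuffles.2 hl, rfl⟩

theorem wordShuffles_one_threeTwoFour :
    wordShuffles [1] [3, 2, 4] = {[1, 3, 2, 4], [3, 1, 2, 4], [3, 2, 1, 4], [3, 2, 4, 1]} := by
  simp [wordShuffles]
  decide

theorem xvar_ne_zero (i : ℕ) : xvar i ≠ 0 := by
  rw [xvar, Ne, IsFractionRing.to_map_eq_zero_iff]
  exact MvPolynomial.X_ne_zero i

theorem xvar_one_sq_ne : xvar 1 * xvar 1 ≠ xvar 0 * xvar 2 := by
  simp only [xvar, ← map_mul]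
  intro h
  -- At this point the left side is 1 and the right side is 0.
  have := congrArg (MvPolynomial.eval (fun i => if i = 1 then (1 : ℚ) else 0))
    (IsFractionRing.injective (MvPolynomial ℕ ℚ) RatFun h)
  simp at this

/-- The four summands are the weights of 1324, 3124, 3214 and 3241, in this order. -/
theorem sum_wt_shuffles_perm1_perm213 :
    ∑ w ∈ shuffles perm1 perm213, wt w =
      xvar 2 / xvar 1 + ((xvar 1 + xvar 2) * xvar 2 / ((xvar 0 + xvar 1) * xvar 1) +
        ((xvar 1 + xvar 2) * xvar 2 / ((xvar 0 + xvar 1) * xvar 1) * (xvar 1 / xvar 0) +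
        (xvar 1 + xvar 2) * xvar 3 / ((xvar 0 + xvar 1) * xvar 1) * (xvar 1 / xvar 0))) := by
  have e : (oneLine perm213).map (fun v => v + perm1.1) = [3, 2, 4] := by
    rw [oneLine_perm213]; rfl
  rw [sum_wt_shuffles, e, oneLine_perm1, wordShuffles_one_threeTwoFour,
    sum_insert (by decide), sum_insert (by decide), sum_insert (by decide), sum_singleton]
  simp [wtWord_cons, positionWeight, lettersBelow, lettersAbove, wtWord_nil, bracketFactorial,
    bracket, frob_xvar, sum_range_succ]

theorem wt_perm1 : wt perm1 = 1 := by
  rw [wt, oneLine_perm1]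
  simp [wtWord_cons, positionWeight, lettersBelow, lettersAbove, wtWord_nil, bracketFactorial]

theorem wt_perm213 : wt perm213 = xvar 1 / xvar 0 := by
  rw [wt, oneLine_perm213]
  simp [wtWord_cons, positionWeight, lettersBelow, lettersAbove, wtWord_nil, bracketFactorial,
    bracket, frob_xvar]

theorem monomialU_injective (n : ℕ) : Function.Injective fun f : RatFun => monomialU f n :=
  SkewMonoidAlgebra.single_injective (Multiplicative.ofAdd n)

theorem phiInv_F_perm1_mul_F_perm213_ne :
    phiInv (FQSym.F perm1 * FQSym.F perm213) ≠
      phiInv (FQSym.F perm1) * phiInv (FQSym.F perm213) := by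
  have hsize : ∀ w ∈ shuffles perm1 perm213, w.1 = 4 := fun w hw => (mem_shuffles.1 hw).size
  rw [FQSym.F_mul_F, phiInv_sum_F hsize, phiInv_F, phiInv_F, monomialU_mul,
    sum_wt_shuffles_perm1_perm213, wt_perm1, wt_perm213]
  intro h
  have h := monomialU_injective 4 h
  have h3 := (map_ne_zero frob).2 (bracketFactorial_ne_zero 3)
  have h4 : bracket 4 ≠ 0 := bracket_ne_zero (by omega)
  have h2 : bracket 2 ≠ 0 := bracket_ne_zero (by omega)
  have e1 : bracketFactorial 1 = xvar 0 := by simp [bracketFactorial, bracket]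
  have e4 : bracket 4 = xvar 0 + xvar 1 + xvar 2 + xvar 3 := by simp [bracket, sum_range_succ]
  have e2 : bracket 2 = xvar 0 + xvar 1 := by simp [bracket, sum_range_succ]
  have n0 := xvar_ne_zero 0
  have n1 := xvar_ne_zero 1
  have n3 := xvar_ne_zero 3
  simp only [perm1, perm213, pow_one, map_mul, map_div₀, map_one, frob_xvar, e1] at h
  rw [bracketFactorial, e4] at h
  rw [e2] at h2
  rw [e4] at h4
  field_simp at h
  -- After clearing denominators, the two coefficients of u⁴ differ by a multiple of `xvar 3 * (xvar
  -- 1 * xvar 1 - xvar 0 * xvar 2)`.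
  apply xvar_one_sq_ne
  apply mul_left_cancel₀ n3
  linear_combination h

theorem mainTheorem2 :
    (∃ A : Subalgebra ℚ FQSym, Subalgebra.toSubmodule A = PBT ∧
      ∃ ψ : A →ₐ[ℚ] SkewAlg, ∀ x : A, ψ x = phiInv (x : FQSym)) ∧
    phiInv (FQSym.F perm1 * FQSym.F perm213) ≠
      phiInv (FQSym.F perm1) * phiInv (FQSym.F perm213) ∧
    ¬ ∀ x y : FQSym, phiInv (x * y) = phiInv x * phiInv y :=
  ⟨⟨PBTSubalgebra, Submodule.toSubalgebra_toSubmodule _ _ _, phiInvPBT, fun _ => rfl⟩,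
    phiInv_F_perm1_mul_F_perm213_ne, fun h => phiInv_F_perm1_mul_F_perm213_ne (h _ _)⟩
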